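/- Let $\mu=(\mu(i))_{i\ge 0}$ be a probability distribution on $\{0,1,2,\dots\}$ with $\sum_{i\ge 0} i\,\mu(i)>1$ (the sum may be infinite), and let $T$ be a Galton–Watson plane tree with offspring distribution $\mu$, conditioned to be infinite. Let $\mathcal C(T)$ be the causal map of $T$: the planar map obtained from $T$ by adding, at every height $n\ge 1$, a horizontal edge from each vertex of height $n$ to the next vertex of height $n$ on its right, the rightmost vertex being joined in this way to the leftmost one (so that a level with two vertices carries a double edge and a level with one vertex carries a loop). The map $\mathcal C(T)$ is rooted at the root $\rho$ of $T$, and is drawn in the plane without crossings and properly (every bounded region meets finitely many vertices and edges): the vertices of height $n$ lie in their left-to-right order on the circle of radius $n$ around $\rho$, the horizontal edges being arcs of this circle. Let $d$ denote the graph distance in $\mathcal C(T)$. Then: 1. Almost surely, $\mathcal C(T)$ is weakly anchored hyperbolic: there is a (random) constant $k\ge 0$ such that, for all vertices $x,y,z$ of $\mathcal C(T)$ and all geodesics $\gamma_{xy}$ from $x$ to $y$, $\gamma_{yz}$ from $y$ to $z$ and $\gamma_{zx}$ from $z$ to $x$, if the triangle formed by $\gamma_{xy},\gamma_{yz},\gamma_{zx}$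 surrounds the root $\rho$ (that is, $\rho$ does not belong to an unbounded connected component of the complement in the plane of the union of the three geodesics), then $$ d\left(\rho,\ \gamma_{xy}\cup\gamma_{yz}\cup\gamma_{zx}\right)\le k. $$ 2. Almost surely, $\mathcal C(T)$ admits a bi-infinite geodesic, that is, a path $(\gamma(i))_{i\in\mathbb Z}$ of vertices such that $d(\gamma(i),\gamma(j))=|i-j|$ for all $i,j\in\mathbb Z$. -/

import Mathlib

open MeasureTheory ProbabilityTheory
open scoped ENNReal

namespace CausalMaps

/-! ### Walks, graph distance and geodesics in a multigraph -/

section Multigraph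

variable {α β : Type*}

/-- `p 0, p 1, …, p n` are the successive vertices of a walk with `n` steps, whose `i`-th step
goes through the edge `e i`. Values of `p` beyond `n` and of `e` beyond `n - 1` are irrelevant. -/
def IsWalk (G : Graph α β) (n : ℕ) (p : ℕ → α) (e : ℕ → β) : Prop :=
  p 0 ∈ G.vertexSet ∧ ∀ i < n, G.IsLink (e i) (p i) (p (i + 1))

/-- The graph distance: the least number of steps of a walk from `x` to `y`
(`⊤` if there is no such walk). -/
noncomputable def graphDist (G : Graph α β) (x y : α) : ℕ∞ :=
  sInf {d : ℕ∞ | ∃ n : ℕ, d = n ∧ ∃ p e, IsWalk G n p e ∧ p 0 = x ∧ p n = y}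

/-- A geodesic from `x` to `y`: a walk whose number of steps is the graph distance. -/
structure Geodesic (G : Graph α β) (x y : α) where
  /-- the number of steps -/
  length : ℕ
  /-- the successive vertices -/
  vert : ℕ → α
  /-- the successive edges -/
  edge : ℕ → β
  isWalk : IsWalk G length vert edge
  start : vert 0 = x
  finish : vert length = y
  length_eq : (length : ℕ∞) = graphDist G x y

/-- The set of vertices visited by a geodesic. -/
def Geodesic.vertices {G : Graph α β} {x y : α} (g : Geodesic G x y) : Set α :=
  {v | ∃ i ≤ g.length, g.vert i = v}

/-- A bi-infinite geodesic: a path indexed by `ℤ` such that the graph distance between its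
`i`-th and `j`-th vertices is exactly `|i - j|`. -/
def IsBiinfiniteGeodesic (G : Graph α β) (γ : ℤ → α) : Prop :=
  (∀ i, γ i ∈ G.vertexSet) ∧ ∀ i j : ℤ, graphDist G (γ i) (γ j) = ((i - j).natAbs : ℕ∞)

end Multigraph

/-! ### Rooted planar maps -/

/-- A rooted planar map: a connected multigraph (loops and multiple edges are allowed) with a
distinguished vertex, properly drawn in the plane without crossings. The edge `e` is drawn as
the curve `arc e s`, `0 ≤ s ≤ 1`. -/
structure RootedPlanarMap (α β : Type*) where
  /-- the underlying multigraph -/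
  graph : Graph α β
  /-- the root vertex -/
  root : α
  root_mem : root ∈ graph.vertexSet
  connected : ∀ v ∈ graph.vertexSet, ∃ n p e, IsWalk graph n p e ∧ p 0 = root ∧ p n = v
  /-- the positions of the vertices -/
  pos : α → ℂ
  /-- the parametrized curves representing the edges -/
  arc : β → ℝ → ℂ
  pos_injOn : Set.InjOn pos graph.vertexSet
  arc_continuous : ∀ e ∈ graph.edgeSet, ContinuousOn (arc e) (Set.Icc 0 1)
  arc_ends : ∀ e x y, graph.IsLink e x y →
    (arc e 0 = pos x ∧ arc e 1 = pos y) ∨ (arc e 0 = pos y ∧ arc e 1 = pos x)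
  arc_injOn : ∀ e ∈ graph.edgeSet, Set.InjOn (arc e) (Set.Ioo 0 1)
  arc_ne_pos : ∀ e ∈ graph.edgeSet, ∀ s ∈ Set.Ioo (0 : ℝ) 1, ∀ v ∈ graph.vertexSet,
    arc e s ≠ pos v
  arc_disjoint : ∀ e ∈ graph.edgeSet, ∀ e' ∈ graph.edgeSet, e ≠ e' →
    ∀ s ∈ Set.Ioo (0 : ℝ) 1, ∀ s' ∈ Set.Ioo (0 : ℝ) 1, arc e s ≠ arc e' s'
  finite_vertices : ∀ R : ℝ, {v | v ∈ graph.vertexSet ∧ ‖pos v‖ ≤ R}.Finite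
  finite_edges : ∀ R : ℝ,
    {e | e ∈ graph.edgeSet ∧ ∃ s ∈ Set.Icc (0 : ℝ) 1, ‖arc e s‖ ≤ R}.Finite

/-- A subset `K` of the plane surrounds the point `z` if `z` does not lie in an unbounded
connected component of the complement of `K`. (A point of `K` itself is surrounded by `K`:
`connectedComponentIn Kᶜ z` is empty in that case.) -/
def Surrounds (K : Set ℂ) (z : ℂ) : Prop :=
  Bornology.IsBounded (connectedComponentIn Kᶜ z)

namespace RootedPlanarMap

variable {α β : Type*} (M : RootedPlanarMap α β)

/-- The subset of the plane covered by a geodesic (its vertices and its edges). -/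
def trace {x y : α} (g : Geodesic M.graph x y) : Set ℂ :=
  {z | ∃ i ≤ g.length, z = M.pos (g.vert i)} ∪
    {z | ∃ i < g.length, ∃ s ∈ Set.Icc (0 : ℝ) 1, z = M.arc (g.edge i) s}

/-- Weak anchored hyperbolicity: there is `k` such that every geodesic triangle which surrounds
the root contains a vertex at graph distance at most `k` from the root. -/
def WeaklyAnchoredHyperbolic : Prop :=
  ∃ k : ℕ, ∀ (x y z : α) (gxy : Geodesic M.graph x y) (gyz : Geodesic M.graph y z)
    (gzx : Geodesic M.graph z x),
    Surrounds (M.trace gxy ∪ M.trace gyz ∪ M.trace gzx) (M.pos M.root) →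
      ∃ v ∈ gxy.vertices ∪ gyz.vertices ∪ gzx.vertices, graphDist M.graph M.root v ≤ k

end RootedPlanarMap

/-! ### Plane trees -/

/-- A locally finite plane tree, as a set of words over `ℕ`: the empty word is the root and the
children of `u`, from left to right, are `u ++ [0]`, `u ++ [1]`, …  The height of a vertex is the
length of the word. At a given height, `u` is on the left of `v` when `u < v` in
the lexicographic order. -/
structure PlaneTree where
  /-- the vertices -/
  verts : Set (List ℕ)
  root_mem : [] ∈ verts
  parent_mem : ∀ u i, u ++ [i] ∈ verts → u ∈ verts
  sibling_mem : ∀ u i j, j ≤ i → u ++ [i] ∈ verts → u ++ [j] ∈ verts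
  finite_children : ∀ u, {i | u ++ [i] ∈ verts}.Finite

namespace PlaneTree

/-- The tree in which every vertex `u` has `c u` children. -/
def ofOffspring (c : List ℕ → ℕ) : PlaneTree where
  verts := {u | ∀ p i, (p ++ [i]) <+: u → i < c p}
  root_mem := by
    intro p i h
    simp at h
  parent_mem := fun u i h p j hp => h p j (hp.trans (List.prefix_append _ _))
  sibling_mem := by
    intro u i j hji h p k hp
    rcases List.prefix_concat_iff.1 hp with hp | hp
    · obtain ⟨rfl, hk⟩ := List.append_inj' hp rfl
      have h1 := h p i (List.prefix_refl _)
      simp at hk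
      omega
    · exact h p k (hp.trans (List.prefix_append _ _))
  finite_children := by
    intro u
    refine (Set.finite_lt_nat (c u)).subset ?_
    intro i hi
    exact hi u i (List.prefix_refl _)

variable (t : PlaneTree)

/-- The set of vertices at height `n`. -/
def level (n : ℕ) : Set (List ℕ) := {u | u ∈ t.verts ∧ u.length = n}

/-- The number of vertices at height `n`. -/
noncomputable def levelCard (n : ℕ) : ℕ := (t.level n).ncard

/-- The number of vertices on the left of `v` at the same height. -/
noncomputable def rank (v : List ℕ) : ℕ := {w | w ∈ t.level v.length ∧ w < v}.ncard

/-- `w` is the right neighbour of `v` in the cyclic order of the vertices at a given height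
(the right neighbour of the rightmost vertex is the leftmost vertex). -/
def IsNext (v w : List ℕ) : Prop :=
  v ∈ t.verts ∧ w ∈ t.level v.length ∧ t.rank w = (t.rank v + 1) % t.levelCard v.length

lemma level_finite (n : ℕ) : (t.level n).Finite := by
  induction n with
  | zero =>
    refine (Set.finite_singleton ([] : List ℕ)).subset ?_
    rintro u ⟨-, hu⟩
    simpa using hu
  | succ n ih =>
    refine (ih.biUnion (t := fun u => (fun i => u ++ [i]) '' {i | u ++ [i] ∈ t.verts})
      (fun u _ => (t.finite_children u).image _)).subset ?_
    rintro v ⟨hv, hl⟩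
    rcases List.eq_nil_or_concat v with rfl | ⟨u, i, rfl⟩
    · simp at hl
    · simp only [List.concat_eq_append] at hv hl ⊢
      simp only [Set.mem_iUnion]
      exact ⟨u, ⟨t.parent_mem _ _ hv, by simpa using hl⟩, i, hv, rfl⟩

lemma rank_lt_levelCard {v : List ℕ} (hv : v ∈ t.verts) :
    t.rank v < t.levelCard v.length := by
  refine Set.ncard_lt_ncard ?_ (t.level_finite _)
  refine ⟨fun w hw => hw.1, fun h => ?_⟩
  exact lt_irrefl v (h (show v ∈ t.level v.length from ⟨hv, rfl⟩)).2

lemma rank_lt_rank {v w : List ℕ} (hv : v ∈ t.verts) (hl : v.length = w.length) (h : v < w) :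
    t.rank v < t.rank w := by
  refine Set.ncard_lt_ncard ?_ ((t.level_finite w.length).subset fun _ h => h.1)
  refine ⟨fun u hu => ⟨hl ▸ hu.1, hu.2.trans h⟩, fun h' => ?_⟩
  exact lt_irrefl v (h' (show v ∈ {u | u ∈ t.level w.length ∧ u < w} from ⟨⟨hv, hl⟩, h⟩)).2

lemma rank_inj {v w : List ℕ} (hv : v ∈ t.verts) (hw : w ∈ t.verts)
    (hl : v.length = w.length) (h : t.rank v = t.rank w) : v = w := by
  rcases lt_trichotomy v w with h1 | h1 | h1
  · exact absurd h (t.rank_lt_rank hv hl h1).ne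
  · exact h1
  · exact absurd h (t.rank_lt_rank hw hl.symm h1).ne'

end PlaneTree

/-! ### The causal map of a plane tree -/

/-- Labels for the edges of a causal map: `tree v` joins `v` to its parent, and `horiz v` joins
`v` to its right neighbour (both only for vertices `v` other than the root). -/
inductive CausalEdge
  | tree (v : List ℕ)
  | horiz (v : List ℕ)

/-- The edge with the given label goes from the first vertex to the second one. -/
def CausalArrow (t : PlaneTree) : CausalEdge → List ℕ → List ℕ → Prop
  | .tree v, x, y => v ∈ t.verts ∧ v ≠ [] ∧ x = v.dropLast ∧ y = v
  | .horiz v, x, y => v ≠ [] ∧ x = v ∧ t.IsNext v y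

lemma CausalArrow.left_mem {t : PlaneTree} {e x y} (h : CausalArrow t e x y) : x ∈ t.verts := by
  cases e with
  | tree v =>
    obtain ⟨hv, hne, rfl, rfl⟩ := h
    rw [← List.dropLast_append_getLast hne] at hv
    exact t.parent_mem _ _ hv
  | horiz v =>
    obtain ⟨-, rfl, h⟩ := h
    exact h.1

lemma CausalArrow.right_mem {t : PlaneTree} {e x y} (h : CausalArrow t e x y) : y ∈ t.verts := by
  cases e with
  | tree v => exact h.2.2.2 ▸ h.1
  | horiz v => exact h.2.2.2.1.1

lemma CausalArrow.unique {t : PlaneTree} {e x y x' y'} (h : CausalArrow t e x y)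
    (h' : CausalArrow t e x' y') : x = x' ∧ y = y' := by
  cases e with
  | tree v =>
    obtain ⟨-, -, rfl, rfl⟩ := h
    obtain ⟨-, -, rfl, rfl⟩ := h'
    exact ⟨rfl, rfl⟩
  | horiz v =>
    obtain ⟨-, rfl, -, h1, h2⟩ := h
    obtain ⟨-, rfl, -, h3, h4⟩ := h'
    exact ⟨rfl, t.rank_inj h1.1 h3.1 (h1.2.trans h3.2.symm) (h2.trans h4.symm)⟩

/-- The causal graph: the tree `t`, together with the horizontal edges between cyclically
consecutive vertices at every height `n ≥ 1`. A level with two vertices carries a double edge and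
a level with one vertex carries a loop. -/
def causalGraph (t : PlaneTree) : Graph (List ℕ) CausalEdge where
  vertexSet := t.verts
  IsLink e x y := CausalArrow t e x y ∨ CausalArrow t e y x
  isLink_symm := fun _ _ => ⟨fun _ _ h => h.symm⟩
  eq_or_eq_of_isLink_of_isLink := by
    rintro e x y v w (h | h) (h' | h')
    · exact Or.inl (h.unique h').1
    · exact Or.inr (h.unique h').1
    · exact Or.inr (h.unique h').2
    · exact Or.inl (h.unique h').2
  left_mem_of_isLink := by
    rintro e x y (h | h)
    · exact h.left_mem
    · exact h.right_mem

/-- The point of the plane with polar radius `r` and angle `θ`, in turns. -/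
noncomputable def polar (r θ : ℝ) : ℂ := r * Complex.exp (2 * Real.pi * θ * Complex.I)

/-- The angle, in turns, at which a vertex is drawn. The vertices at height `n` are equally
spaced, from left to right, on the circle of radius `n`. -/
noncomputable def angle (t : PlaneTree) (v : List ℕ) : ℝ :=
  (t.rank v : ℝ) / t.levelCard v.length

/-- The drawing of the edges: horizontal edges are drawn as arcs of circles; along a tree edge,
the radius and the angle are interpolated linearly. -/
noncomputable def causalArc (t : PlaneTree) : CausalEdge → ℝ → ℂ
  | .tree v, s => polar (v.length - 1 + s) ((1 - s) * angle t v.dropLast + s * angle t v)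
  | .horiz v, s => polar v.length (((t.rank v : ℝ) + s) / t.levelCard v.length)

lemma norm_polar {r : ℝ} (hr : 0 ≤ r) (θ : ℝ) : ‖polar r θ‖ = r := by
  have h : (2 * Real.pi * θ * Complex.I : ℂ) = ((2 * Real.pi * θ : ℝ) : ℂ) * Complex.I := by
    push_cast; ring
  rw [polar, norm_mul, h, Complex.norm_exp_ofReal_mul_I, Complex.norm_real, Real.norm_eq_abs,
    abs_of_nonneg hr, mul_one]

lemma polar_eq {r r' θ θ' : ℝ} (hr : 0 ≤ r) (hr' : 0 ≤ r') (h : polar r θ = polar r' θ') :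
    r = r' ∧ (0 < r → ∃ k : ℤ, θ = θ' + k) := by
  have h1 : r = r' := by rw [← norm_polar hr θ, h, norm_polar hr' θ']
  subst h1
  refine ⟨rfl, fun hpos => ?_⟩
  have h0 : (r : ℂ) ≠ 0 := by exact_mod_cast hpos.ne'
  obtain ⟨k, hk⟩ := Complex.exp_eq_exp_iff_exists_int.1 (mul_left_cancel₀ h0 h)
  refine ⟨k, ?_⟩
  have h2 : (2 * Real.pi * Complex.I : ℂ) ≠ 0 := Complex.two_pi_I_ne_zero
  have h3 : (2 * Real.pi * Complex.I : ℂ) * θ = 2 * Real.pi * Complex.I * (θ' + k) := by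
    linear_combination hk
  exact_mod_cast mul_left_cancel₀ h2 h3

lemma polar_add_int (r θ : ℝ) (k : ℤ) : polar r (θ + k) = polar r θ := by
  rw [polar, polar]
  congr 1
  refine Complex.exp_eq_exp_iff_exists_int.2 ⟨k, ?_⟩
  push_cast; ring

lemma int_eq_zero_of_unit {a b : ℝ} {k : ℤ} (ha : 0 ≤ a) (ha' : a < 1) (hb : 0 ≤ b) (hb' : b < 1)
    (h : a = b + k) : k = 0 := by
  have h1 : (k : ℝ) < 1 := by linarith
  have h2 : (-1 : ℝ) < k := by linarith
  have h3 : k < 1 := by exact_mod_cast h1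
  have h4 : -1 < k := by exact_mod_cast h2
  omega

lemma nat_eq_of_add_unit {m n : ℕ} {a b : ℝ} (ha : 0 < a) (ha' : a < 1) (hb : 0 ≤ b)
    (hb' : b < 1) (h : (m : ℝ) + a = n + b) : m = n ∧ a = b := by
  have h1 : (m : ℝ) < n + 1 := by linarith
  have h2 : (n : ℝ) < m + 1 := by linarith
  have h3 : m < n + 1 := by exact_mod_cast h1
  have h4 : n < m + 1 := by exact_mod_cast h2
  have h5 : m = n := by omega
  subst h5
  exact ⟨rfl, by linarith⟩

section Drawing

variable {t : PlaneTree}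

lemma angle_nonneg (v : List ℕ) : 0 ≤ angle t v := by unfold angle; positivity

lemma levelCard_pos {v : List ℕ} (hv : v ∈ t.verts) : (0 : ℝ) < t.levelCard v.length := by
  have := t.rank_lt_levelCard hv
  exact_mod_cast (by omega : 0 < t.levelCard v.length)

lemma angle_lt_one {v : List ℕ} (hv : v ∈ t.verts) : angle t v < 1 := by
  rw [angle, div_lt_one (levelCard_pos hv)]
  exact_mod_cast t.rank_lt_levelCard hv

lemma angle_lt_angle {v w : List ℕ} (hv : v ∈ t.verts) (hl : v.length = w.length) (h : v < w) :
    angle t v < angle t w := by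
  rw [angle, angle, ← hl]
  refine div_lt_div_of_pos_right ?_ (levelCard_pos hv)
  exact_mod_cast t.rank_lt_rank hv hl h

lemma dropLast_mem {v : List ℕ} (hv : v ∈ t.verts) : v.dropLast ∈ t.verts := by
  rcases List.eq_nil_or_concat v with rfl | ⟨u, i, rfl⟩
  · exact hv
  · simp only [List.concat_eq_append, List.dropLast_concat] at hv ⊢
    exact t.parent_mem _ _ hv

lemma lt_or_eq_of_append_lt : ∀ {p q : List ℕ} {i j : ℕ}, p.length = q.length →
    p ++ [i] < q ++ [j] → p < q ∨ p = q
  | [], [], _, _, _, _ => Or.inr rfl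
  | [], _ :: _, _, _, h, _ => by simp at h
  | _ :: _, [], _, _, h, _ => by simp at h
  | a :: p, b :: q, i, j, hl, h => by
    rcases List.cons_lt_cons_iff.1 (show a :: (p ++ [i]) < b :: (q ++ [j]) from h) with
      h1 | ⟨rfl, h1⟩
    · exact Or.inl (List.cons_lt_cons_iff.2 (Or.inl h1))
    · have h2 : p.length = q.length := by simpa using hl
      rcases lt_or_eq_of_append_lt h2 h1 with h3 | h3
      · exact Or.inl (List.cons_lt_cons_iff.2 (Or.inr ⟨rfl, h3⟩))
      · exact Or.inr (by rw [h3])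

lemma dropLast_lt_or_eq {v w : List ℕ} (hl : v.length = w.length) (h : v < w) :
    v.dropLast < w.dropLast ∨ v.dropLast = w.dropLast := by
  rcases List.eq_nil_or_concat v with rfl | ⟨u, i, rfl⟩
  · rw [List.length_eq_zero_iff.1 hl.symm]
    exact Or.inr rfl
  rcases List.eq_nil_or_concat w with rfl | ⟨u', j, rfl⟩
  · simp at hl
  simp only [List.concat_eq_append, List.dropLast_concat] at *
  exact lt_or_eq_of_append_lt (by simpa using hl) h

lemma angle_le_angle {v w : List ℕ} (hv : v ∈ t.verts) (hl : v.length = w.length)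
    (h : v < w ∨ v = w) : angle t v ≤ angle t w := by
  rcases h with h | rfl
  · exact (angle_lt_angle hv hl h).le
  · rfl

lemma treeAngle_lt {v w : List ℕ} (hv : v ∈ t.verts) (hl : v.length = w.length) (h : v < w)
    {s : ℝ} (hs : s ∈ Set.Ioo (0 : ℝ) 1) :
    (1 - s) * angle t v.dropLast + s * angle t v <
      (1 - s) * angle t w.dropLast + s * angle t w := by
  have h1 := angle_lt_angle hv hl h
  have h2 := angle_le_angle (dropLast_mem hv) (by simp [hl]) (dropLast_lt_or_eq hl h)
  have h3 := mul_lt_mul_of_pos_left h1 hs.1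
  have h4 := mul_le_mul_of_nonneg_left h2 (sub_nonneg.2 hs.2.le)
  linarith

lemma treeAngle_mem {v : List ℕ} (hv : v ∈ t.verts) {s : ℝ} (hs : s ∈ Set.Ioo (0 : ℝ) 1) :
    0 ≤ (1 - s) * angle t v.dropLast + s * angle t v ∧
      (1 - s) * angle t v.dropLast + s * angle t v < 1 := by
  have h1 := angle_nonneg (t := t) v
  have h2 := angle_nonneg (t := t) v.dropLast
  have h3 := mul_lt_mul_of_pos_left (angle_lt_one hv) hs.1
  have h4 := mul_le_mul_of_nonneg_left (angle_lt_one (dropLast_mem hv)).le (sub_nonneg.2 hs.2.le)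
  have h5 := mul_nonneg hs.1.le h1
  have h6 := mul_nonneg (sub_nonneg.2 hs.2.le) h2
  constructor <;> linarith

lemma horizAngle_mem {v : List ℕ} (hv : v ∈ t.verts) {s : ℝ} (hs : 0 ≤ s) (hs' : s < 1) :
    0 ≤ ((t.rank v : ℝ) + s) / t.levelCard v.length ∧
      ((t.rank v : ℝ) + s) / t.levelCard v.length < 1 := by
  refine ⟨by positivity, ?_⟩
  rw [div_lt_one (levelCard_pos hv)]
  have h : ((t.rank v + 1 : ℕ) : ℝ) ≤ t.levelCard v.length := by
    exact_mod_cast t.rank_lt_levelCard hv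
  push_cast at h
  linarith

lemma horiz_eq {v w : List ℕ} (hv : v ∈ t.verts) (hw : w ∈ t.verts) (hne : v ≠ []) {s s' : ℝ}
    (hs : 0 < s) (hs1 : s < 1) (hs' : 0 ≤ s') (hs1' : s' < 1)
    (h : polar v.length (((t.rank v : ℝ) + s) / t.levelCard v.length) =
      polar w.length (((t.rank w : ℝ) + s') / t.levelCard w.length)) : v = w ∧ s = s' := by
  obtain ⟨h1, h2⟩ := polar_eq (by positivity) (by positivity) h
  have hl : v.length = w.length := by exact_mod_cast h1
  obtain ⟨k, hk⟩ := h2 (by exact_mod_cast List.length_pos_iff.2 hne)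
  obtain ⟨a1, a2⟩ := horizAngle_mem hv hs.le hs1
  obtain ⟨b1, b2⟩ := horizAngle_mem hw hs' hs1'
  have hk0 := int_eq_zero_of_unit a1 a2 b1 b2 hk
  rw [hk0, ← hl, Int.cast_zero, add_zero, div_left_inj' (levelCard_pos hv).ne'] at hk
  obtain ⟨e1, e2⟩ := nat_eq_of_add_unit hs hs1 hs' hs1' hk
  exact ⟨t.rank_inj hv hw hl e1, e2⟩

lemma take_mem {v : List ℕ} (hv : v ∈ t.verts) (i : ℕ) : v.take i ∈ t.verts := by
  induction v using List.reverseRecOn with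
  | nil => simpa using hv
  | append_singleton u a ih =>
    rcases Nat.lt_or_ge u.length i with h | h
    · rwa [List.take_of_length_le (by simp; omega)]
    · rw [List.take_append_of_le_length h]
      exact ih (t.parent_mem _ _ hv)

lemma causalGraph_connected {v : List ℕ} (hv : v ∈ t.verts) :
    ∃ n p e, IsWalk (causalGraph t) n p e ∧ p 0 = [] ∧ p n = v := by
  refine ⟨v.length, fun i => v.take i, fun i => .tree (v.take (i + 1)),
    ⟨take_mem hv 0, fun i hi => Or.inl ⟨take_mem hv _, ?_, ?_, rfl⟩⟩, by simp, by simp⟩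
  · intro h
    have := congrArg List.length h
    simp at this
    simp [this] at hi
  · change v.take i = (v.take (i + 1)).dropLast
    rw [← List.take_concat_get' v i hi, List.dropLast_concat]

lemma tree_mem_edgeSet {v : List ℕ} (h : CausalEdge.tree v ∈ (causalGraph t).edgeSet) :
    v ∈ t.verts ∧ 1 ≤ v.length := by
  obtain ⟨x, y, h | h⟩ := h <;>
  exact ⟨h.1, List.length_pos_iff.2 h.2.1⟩

lemma horiz_mem_edgeSet {v : List ℕ} (h : CausalEdge.horiz v ∈ (causalGraph t).edgeSet) :
    v ∈ t.verts ∧ v ≠ [] := by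
  obtain ⟨x, y, h | h⟩ := h <;>
  exact ⟨h.2.2.1, h.1⟩

lemma tree_eq {v w : List ℕ} (hv : v ∈ t.verts) (hw : w ∈ t.verts) (hv1 : 1 ≤ v.length)
    (hw1 : 1 ≤ w.length) {s s' : ℝ} (hs : s ∈ Set.Ioo (0 : ℝ) 1) (hs' : s' ∈ Set.Ioo (0 : ℝ) 1)
    (h : causalArc t (.tree v) s = causalArc t (.tree w) s') : v = w ∧ s = s' := by
  have hv2 : (1 : ℝ) ≤ v.length := by exact_mod_cast hv1
  have hw2 : (1 : ℝ) ≤ w.length := by exact_mod_cast hw1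
  obtain ⟨h1, h2⟩ := polar_eq (by linarith [hs.1]) (by linarith [hs'.1]) h
  obtain ⟨hl, rfl⟩ := nat_eq_of_add_unit (m := v.length) (n := w.length) hs.1 hs.2 hs'.1.le hs'.2
    (by linarith)
  refine ⟨?_, rfl⟩
  obtain ⟨k, hk⟩ := h2 (by linarith [hs.1])
  obtain ⟨a1, a2⟩ := treeAngle_mem hv hs
  obtain ⟨b1, b2⟩ := treeAngle_mem hw hs
  rw [int_eq_zero_of_unit a1 a2 b1 b2 hk, Int.cast_zero, add_zero] at hk
  rcases lt_trichotomy v w with h3 | h3 | h3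
  · exact absurd hk (treeAngle_lt hv hl h3 hs).ne
  · exact h3
  · exact absurd hk (treeAngle_lt hw hl.symm h3 hs).ne'

lemma tree_norm_ne {v : List ℕ} (hv1 : 1 ≤ v.length) {s : ℝ} (hs : s ∈ Set.Ioo (0 : ℝ) 1)
    (n : ℕ) (θ : ℝ) : causalArc t (.tree v) s ≠ polar n θ := by
  intro h
  have hv2 : (1 : ℝ) ≤ v.length := by exact_mod_cast hv1
  obtain ⟨h1, -⟩ := polar_eq (by linarith [hs.1]) (by positivity) h
  have h2 := nat_eq_of_add_unit (m := v.length) (n := n + 1) hs.1 hs.2 le_rfl zero_lt_one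
    (by push_cast; linarith)
  exact hs.1.ne' h2.2

lemma finite_length_le (t : PlaneTree) (R : ℝ) :
    {v | v ∈ t.verts ∧ (v.length : ℝ) ≤ R}.Finite := by
  refine ((Set.finite_le_nat ⌊R⌋₊).biUnion (t := fun n => t.level n)
    (fun n _ => t.level_finite n)).subset ?_
  rintro v ⟨hv, hl⟩
  simp only [Set.mem_iUnion]
  exact ⟨v.length, Nat.le_floor hl, hv, rfl⟩

lemma arrow_ends {e : CausalEdge} {x y : List ℕ} (h : CausalArrow t e x y) :
    causalArc t e 0 = polar x.length (angle t x) ∧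
      causalArc t e 1 = polar y.length (angle t y) := by
  cases e with
  | tree v =>
    obtain ⟨hv, hne, rfl, rfl⟩ := h
    have hl : 1 ≤ y.length := List.length_pos_iff.2 hne
    simp [causalArc, Nat.cast_sub hl]
  | horiz v =>
    obtain ⟨hne, rfl, hx, hy, hr⟩ := h
    refine ⟨by simp [causalArc, angle], ?_⟩
    have hpos := levelCard_pos hx
    have hlt := t.rank_lt_levelCard hx
    simp only [causalArc, angle]
    rw [hy.2]
    rcases Nat.lt_or_ge (t.rank x + 1) (t.levelCard x.length) with h1 | h1
    · rw [hr, Nat.mod_eq_of_lt h1]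
      push_cast
      rfl
    · have h2 : t.rank x + 1 = t.levelCard x.length := by omega
      rw [hr, h2, Nat.mod_self]
      have h3 : ((t.rank x : ℝ) + 1) / t.levelCard x.length = 0 + (1 : ℤ) := by
        rw [← h2]
        push_cast
        rw [zero_add]
        exact div_self (by positivity)
      rw [h3, polar_add_int]
      simp

end Drawing

/-- The causal map of a plane tree, rooted at the root of the tree. -/
noncomputable def causalMap (t : PlaneTree) : RootedPlanarMap (List ℕ) CausalEdge where
  graph := causalGraph t
  root := []
  root_mem := t.root_mem
  connected := fun _ hv => causalGraph_connected hv
  pos v := polar v.length (angle t v)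
  arc := causalArc t
  pos_injOn := by
    intro v hv w hw h
    obtain ⟨h1, h2⟩ := polar_eq (by positivity) (by positivity) h
    have hl : v.length = w.length := by exact_mod_cast h1
    rcases Nat.eq_zero_or_pos v.length with h0 | h0
    · exact (List.length_eq_zero_iff.1 h0).trans (List.length_eq_zero_iff.1 (hl.symm.trans h0)).symm
    obtain ⟨k, hk⟩ := h2 (by exact_mod_cast h0)
    rw [int_eq_zero_of_unit (angle_nonneg _) (angle_lt_one hv) (angle_nonneg _) (angle_lt_one hw)
      hk, Int.cast_zero, add_zero] at hk
    rcases lt_trichotomy v w with h3 | h3 | h3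
    · exact absurd hk (angle_lt_angle hv hl h3).ne
    · exact h3
    · exact absurd hk (angle_lt_angle hw hl.symm h3).ne'
  arc_continuous := by
    rintro (v | v) - <;>
    · unfold causalArc polar
      fun_prop
  arc_ends := by
    rintro e x y (h | h)
    · exact Or.inl (arrow_ends h)
    · exact Or.inr (arrow_ends h)
  arc_injOn := by
    rintro (v | v) he s hs s' hs' h
    · obtain ⟨hv, hv1⟩ := tree_mem_edgeSet he
      exact (tree_eq hv hv hv1 hv1 hs hs' h).2
    · obtain ⟨hv, hv1⟩ := horiz_mem_edgeSet he
      exact (horiz_eq hv hv hv1 hs.1 hs.2 hs'.1.le hs'.2 h).2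
  arc_ne_pos := by
    rintro (v | v) he s hs w hw h
    · obtain ⟨hv, hv1⟩ := tree_mem_edgeSet he
      exact tree_norm_ne hv1 hs _ _ h
    · obtain ⟨hv, hv1⟩ := horiz_mem_edgeSet he
      exact hs.1.ne' (horiz_eq hv hw hv1 hs.1 hs.2 le_rfl zero_lt_one
        (by simpa [causalArc, angle] using h)).2
  arc_disjoint := by
    rintro (v | v) he (w | w) he' hne s hs s' hs' h
    · obtain ⟨hv, hv1⟩ := tree_mem_edgeSet he
      obtain ⟨hw, hw1⟩ := tree_mem_edgeSet he'
      exact hne (by rw [(tree_eq hv hw hv1 hw1 hs hs' h).1])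
    · obtain ⟨hv, hv1⟩ := tree_mem_edgeSet he
      exact tree_norm_ne hv1 hs _ _ h
    · obtain ⟨hv, hv1⟩ := tree_mem_edgeSet he'
      exact tree_norm_ne hv1 hs' _ _ h.symm
    · obtain ⟨hv, hv1⟩ := horiz_mem_edgeSet he
      obtain ⟨hw, hw1⟩ := horiz_mem_edgeSet he'
      exact hne (by rw [(horiz_eq hv hw hv1 hs.1 hs.2 hs'.1.le hs'.2 h).1])
  finite_vertices := by
    intro R
    refine (finite_length_le t R).subset ?_
    rintro v ⟨hv, hR⟩
    rw [norm_polar (by positivity)] at hR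
    exact ⟨hv, hR⟩
  finite_edges := by
    intro R
    refine (((finite_length_le t (R + 1)).image CausalEdge.tree).union
      ((finite_length_le t (R + 1)).image CausalEdge.horiz)).subset ?_
    rintro (v | v) ⟨he, s, hs, hR⟩
    · obtain ⟨hv, hv1⟩ := tree_mem_edgeSet he
      have hv2 : (1 : ℝ) ≤ v.length := by exact_mod_cast hv1
      rw [causalArc, norm_polar (by linarith [hs.1])] at hR
      exact Or.inl ⟨v, ⟨hv, by linarith [hs.1]⟩, rfl⟩
    · obtain ⟨hv, -⟩ := horiz_mem_edgeSet he
      rw [causalArc, norm_polar (by positivity)] at hR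
      exact Or.inr ⟨v, ⟨hv, by linarith⟩, rfl⟩

/-! ### Galton–Watson trees -/

/-- The Galton–Watson tree built from the offspring numbers `N u`: in the realization `ω`, the
vertex `u` has `N u ω` children. -/
def gwTree {Ω : Type*} (N : List ℕ → Ω → ℕ) (ω : Ω) : PlaneTree :=
  PlaneTree.ofOffspring fun u => N u ω

/-- The event that the Galton–Watson tree survives, i.e. is infinite. -/
def survival {Ω : Type*} (N : List ℕ → Ω → ℕ) : Set Ω :=
  {ω | (gwTree N ω).verts.Infinite}

end CausalMaps

/-!
The geometric input is that a geodesic from `x` to `y` is at most as long as the path through the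
root, that is, `|x| + |y|` where `|·|` is the height. If its least height is `h`, at least
`|x| + |y| - 2 * h` of its steps are vertical, so at most `2 * h` are horizontal. A vertical step
does not change the ancestor at height `h`, hence the geodesic has only `O(h)` ancestors at
height `h` (`Geodesic.card_ancestors_le`). These ancestors form a cutset: a ray which avoids them
does not meet the geodesic.

This is played against a *thin flow*: a unit flow from the root to infinity in the tree such that
the flow through a vertex at height `h` is `o(1 / h)` uniformly. If there is one, the cutset of a
geodesic which stays far from the root carries little flow, and a set which carries less flow than
a vertex `u` is avoided by some ray through `u` (`IsFlow.exists_ray`).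

* Weak anchored hyperbolicity (`IsFlow.weaklyAnchoredHyperbolic`): the cutsets of three geodesics
  far from the root carry less than the total flow, so some ray avoids the triangle. As this ray is
  drawn as a connected unbounded set containing the root, the triangle does not surround the root.
* Bi-infinite geodesics (`IsFlow.exists_isBiinfiniteGeodesic`): take `u₀ < u₁ < u₂ < u₃` at the same
  height, all with positive flow, and join a far vertex above `u₀` to one above `u₂`. A geodesic far
  from the root would avoid a ray through `u₁` and a ray through `u₃`, but these two rays separate
  the map (`IsWalk.between_iff`). So these geodesics visit a fixed finite set, and by compactness
  they have a bi-infinite limit.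

A supercritical Galton–Watson tree has a thin flow almost surely on survival
(`ae_isThin_splitFlow`), namely the flow `splitFlow` which is split equally among the children with
an infinite subtree. Conditioning on the first generation, the mean of the sum of the squares of
the flow over a level is multiplied by the same constant `energyFactor` from each level to the
next. This constant is the mean of `1 / D` conditionally on survival, where `D` is the number of
children of the root with an infinite subtree; it is less than `1` because `D ≥ 2` with positive
probability. The squares being summable, even with
polynomial weights, the flow is thin. No moment of the offspring law is needed.
-/

namespace CausalMaps

/-! ### Walks and graph distance -/

section Walks

variable {α β : Type*} {G : Graph α β}

lemma IsWalk.mem {n : ℕ} {p : ℕ → α} {e : ℕ → β} (h : IsWalk G n p e) {i : ℕ} (hi : i ≤ n) :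
    p i ∈ G.vertexSet := by
  cases i with
  | zero => exact h.1
  | succ i => exact (h.2 i hi).right_mem

/-- There is a walk with exactly `n` steps from `x` to `y`. -/
def Reach (G : Graph α β) (n : ℕ) (x y : α) : Prop :=
  ∃ p e, IsWalk G n p e ∧ p 0 = x ∧ p n = y

lemma IsWalk.reach {n : ℕ} {p : ℕ → α} {e : ℕ → β} (h : IsWalk G n p e) {i j : ℕ} (hij : i ≤ j)
    (hj : j ≤ n) : Reach G (j - i) (p i) (p j) := by
  refine ⟨fun k => p (i + k), fun k => e (i + k), ⟨h.mem (hij.trans hj), fun k hk => ?_⟩, rfl, ?_⟩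
  · exact h.2 (i + k) (by omega)
  · simp [Nat.add_sub_cancel' hij]

lemma Reach.trans {m n : ℕ} {x y z : α} (h : Reach G m x y) (h' : Reach G n y z) :
    Reach G (m + n) x z := by
  obtain ⟨p, e, hp, rfl, rfl⟩ := h
  obtain ⟨q, f, hq, hq0, rfl⟩ := h'
  refine ⟨fun k => if k ≤ m then p k else q (k - m), fun k => if k < m then e k else f (k - m),
    ⟨by simpa using hp.1, fun k hk => ?_⟩, by simp, ?_⟩
  · rcases lt_trichotomy k m with h1 | rfl | h1
    · simpa [h1, h1.le, Nat.succ_le_of_lt h1] using hp.2 k h1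
    · have := hq.2 0 (by omega)
      rw [hq0] at this
      simpa using this
    · have := hq.2 (k - m) (by omega)
      rw [show k - m + 1 = k + 1 - m by omega] at this
      simpa [h1.not_ge, h1.not_gt, show ¬ k + 1 ≤ m by omega] using this
  · rcases Nat.eq_zero_or_pos n with rfl | hn
    · simp [hq0]
    · simp [hn.ne']

lemma Reach.symm {n : ℕ} {x y : α} (h : Reach G n x y) : Reach G n y x := by
  obtain ⟨p, e, hp, rfl, rfl⟩ := h
  refine ⟨fun k => p (n - k), fun k => e (n - 1 - k), ⟨by simpa using hp.mem le_rfl,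
    fun k hk => ?_⟩, by simp, by simp⟩
  have := (hp.2 (n - 1 - k) (by omega)).symm
  rwa [show n - 1 - k + 1 = n - k by omega, show p (n - 1 - k) = p (n - (k + 1)) by
    congr 1; omega] at this

lemma Reach.graphDist_le {n : ℕ} {x y : α} (h : Reach G n x y) : graphDist G x y ≤ n :=
  sInf_le ⟨n, rfl, h⟩

lemma exists_reach_eq_graphDist {x y : α} {n : ℕ} (h : Reach G n x y) :
    ∃ m : ℕ, (m : ℕ∞) = graphDist G x y ∧ Reach G m x y := by
  obtain ⟨m, hm, h'⟩ := csInf_mem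
    (s := {d : ℕ∞ | ∃ n : ℕ, d = n ∧ ∃ p e, IsWalk G n p e ∧ p 0 = x ∧ p n = y}) ⟨n, n, rfl, h⟩
  exact ⟨m, hm.symm, h'⟩

lemma graphDist_comm (x y : α) : graphDist G x y = graphDist G y x := by
  unfold graphDist
  congr 1
  ext d
  exact ⟨fun ⟨n, h, h'⟩ => ⟨n, h, Reach.symm h'⟩, fun ⟨n, h, h'⟩ => ⟨n, h, Reach.symm h'⟩⟩

lemma Reach.exists_geodesic {n : ℕ} {x y : α} (h : Reach G n x y) : Nonempty (Geodesic G x y) := by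
  obtain ⟨m, hm, p, e, hp, h0, h1⟩ := exists_reach_eq_graphDist h
  exact ⟨⟨m, p, e, hp, h0, h1, hm⟩⟩

lemma Geodesic.length_le {x y : α} (g : Geodesic G x y) {n : ℕ} (h : Reach G n x y) :
    g.length ≤ n := by
  have := h.graphDist_le
  rw [← g.length_eq] at this
  exact_mod_cast this

lemma Geodesic.graphDist_vert {x y : α} (g : Geodesic G x y) {i j : ℕ} (hij : i ≤ j)
    (hj : j ≤ g.length) : graphDist G (g.vert i) (g.vert j) = (j - i : ℕ) := by
  obtain ⟨m, hm, hr⟩ := exists_reach_eq_graphDist (g.isWalk.reach hij hj)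
  have h1 := g.isWalk.reach (Nat.zero_le i) (hij.trans hj)
  have h2 := g.isWalk.reach hj le_rfl
  rw [g.start] at h1
  rw [g.finish] at h2
  have h3 := g.length_le ((h1.trans hr).trans h2)
  have h4 := (g.isWalk.reach hij hj).graphDist_le
  rw [← hm] at h4 ⊢
  have h5 : m ≤ j - i := by exact_mod_cast h4
  have h6 : m = j - i := by omega
  rw [h6]

end Walks

/-! ### Heights and ancestors along a walk of a causal map -/

section Causal

variable {t : PlaneTree}

lemma reach_root {v : List ℕ} (hv : v ∈ t.verts) : Reach (causalGraph t) v.length [] v := by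
  refine ⟨fun i => v.take i, fun i => .tree (v.take (i + 1)),
    ⟨take_mem hv 0, fun i hi => Or.inl ⟨take_mem hv _, ?_, ?_, rfl⟩⟩, by simp, by simp⟩
  · intro h
    have := congrArg List.length h
    simp at this
    simp [this] at hi
  · change v.take i = (v.take (i + 1)).dropLast
    rw [← List.take_concat_get' v i hi, List.dropLast_concat]

/-- Going through the root bounds the length of a geodesic by the sum of the heights of its
ends. -/
lemma Geodesic.length_le_add {x y : List ℕ} (g : Geodesic (causalGraph t) x y) :
    g.length ≤ x.length + y.length := by
  have hx : x ∈ t.verts := g.start ▸ g.isWalk.1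
  have hy : y ∈ t.verts := g.finish ▸ g.isWalk.mem le_rfl
  exact g.length_le ((reach_root hx).symm.trans (reach_root hy))

/-- A step of a walk is either vertical, along a tree edge, or horizontal. -/
lemma isLink_cases {e : CausalEdge} {x y : List ℕ} (h : (causalGraph t).IsLink e x y) :
    (∃ i, y = x ++ [i]) ∨ (∃ i, x = y ++ [i]) ∨
      (x ≠ [] ∧ x.length = y.length ∧ (t.IsNext x y ∨ t.IsNext y x)) := by
  rcases h with h | h <;> cases e with
  | tree v =>
    obtain ⟨-, hne, rfl, rfl⟩ := h
    have := (List.dropLast_append_getLast hne).symm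
    first
    | exact Or.inl ⟨_, this⟩
    | exact Or.inr (Or.inl ⟨_, this⟩)
  | horiz v =>
    obtain ⟨hne, rfl, h⟩ := h
    have hl := h.2.1.2
    refine Or.inr (Or.inr ⟨?_, by omega, ?_⟩)
    · first
      | exact hne
      | exact fun h0 => hne (List.length_eq_zero_iff.1 (by simp [← hl, h0]))
    · first
      | exact Or.inl h
      | exact Or.inr h

lemma length_step {e : CausalEdge} {x y : List ℕ} (h : (causalGraph t).IsLink e x y) :
    x.length ≤ y.length + 1 ∧ y.length ≤ x.length + 1 := by
  rcases isLink_cases h with ⟨i, rfl⟩ | ⟨i, rfl⟩ | ⟨-, h, -⟩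
  · simp; omega
  · simp; omega
  · omega

lemma IsWalk.height_le {n : ℕ} {p : ℕ → List ℕ} {e : ℕ → CausalEdge}
    (h : IsWalk (causalGraph t) n p e) {i j : ℕ} (hij : i ≤ j) (hj : j ≤ n) :
    (p i).length ≤ (p j).length + (j - i) ∧ (p j).length ≤ (p i).length + (j - i) := by
  induction j, hij using Nat.le_induction with
  | base => simp
  | succ j hij ih =>
    have h1 := ih (by omega)
    have h2 := length_step (h.2 j (by omega))
    omega

/-- As long as a walk stays above height `h`, a vertical step keeps the ancestor at height `h`
and changes the height by one, while a horizontal step visits at most one new ancestor. -/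
lemma IsWalk.card_ancestors_add_le {n : ℕ} {p : ℕ → List ℕ} {e : ℕ → CausalEdge}
    (hw : IsWalk (causalGraph t) n p e) {h : ℕ} (hh : ∀ i ≤ n, h ≤ (p i).length) {i j : ℕ}
    (hij : i ≤ j) (hj : j ≤ n) :
    ((Finset.Icc i j).image fun k => (p k).take h).card +
      (((p i).length - (p j).length) + ((p j).length - (p i).length)) ≤ 1 + (j - i) := by
  induction j, hij using Nat.le_induction with
  | base => simp
  | succ j hij ih =>
    have h1 := ih (by omega)
    have hI : (Finset.Icc i (j + 1)).image (fun k => (p k).take h) =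
        insert ((p (j + 1)).take h) ((Finset.Icc i j).image fun k => (p k).take h) := by
      rw [← Finset.image_insert (fun k => (p k).take h)]
      congr 1
      ext k
      simp
      omega
    rw [hI]
    have hA := hh j (by omega)
    have hB := hh (j + 1) hj
    have hmem : (p j).take h ∈ (Finset.Icc i j).image fun k => (p k).take h :=
      Finset.mem_image_of_mem _ (by simp [hij])
    rcases isLink_cases (hw.2 j (by omega)) with ⟨a, ha⟩ | ⟨a, ha⟩ | ⟨-, hl, -⟩
    · have hl : (p (j + 1)).length = (p j).length + 1 := by simp [ha]
      rw [show (p (j + 1)).take h = (p j).take h by rw [ha, List.take_append_of_le_length hA],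
        Finset.insert_eq_of_mem hmem]
      omega
    · have hl : (p j).length = (p (j + 1)).length + 1 := by simp [ha]
      rw [show (p (j + 1)).take h = (p j).take h by rw [ha, List.take_append_of_le_length hB],
        Finset.insert_eq_of_mem hmem]
      omega
    · have := Finset.card_insert_le ((p (j + 1)).take h)
        ((Finset.Icc i j).image fun k => (p k).take h)
      omega

/-- The ancestors at height `h` of the vertices of a geodesic. A vertex of height less than `h`
contributes itself. -/
noncomputable def Geodesic.ancestors {x y : List ℕ} (g : Geodesic (causalGraph t) x y) (h : ℕ) :
    Finset (List ℕ) :=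
  (Finset.Icc 0 g.length).image fun k => (g.vert k).take h

lemma Geodesic.mem_ancestors {x y : List ℕ} (g : Geodesic (causalGraph t) x y) (h : ℕ) {k : ℕ}
    (hk : k ≤ g.length) : (g.vert k).take h ∈ g.ancestors h :=
  Finset.mem_image_of_mem _ (by simp [hk])

/-- The key estimate: a geodesic which reaches height `h`, and stays above it, has at most
`2 * h` horizontal steps, hence few ancestors at height `h`. -/
lemma Geodesic.card_ancestors_le {x y : List ℕ} (g : Geodesic (causalGraph t) x y) {h m : ℕ}
    (hh : ∀ i ≤ g.length, h ≤ (g.vert i).length) (hm : m ≤ g.length)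
    (hmh : (g.vert m).length = h) : (g.ancestors h).card ≤ 2 * h + 2 := by
  have h1 := g.isWalk.card_ancestors_add_le hh (Nat.zero_le m) hm
  have h2 := g.isWalk.card_ancestors_add_le hh hm le_rfl
  have h3 := g.length_le_add
  have h4 : g.ancestors h ⊆ (Finset.Icc 0 m).image (fun k => (g.vert k).take h) ∪
      (Finset.Icc m g.length).image (fun k => (g.vert k).take h) := by
    rw [← Finset.image_union]
    refine Finset.image_subset_image fun k hk => ?_
    simp at hk ⊢
    omega
  have h5 := (Finset.card_le_card h4).trans (Finset.card_union_le _ _)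
  rw [g.start] at h1
  rw [g.finish] at h2
  have h6 := hh 0 (Nat.zero_le _)
  have h7 := hh g.length le_rfl
  rw [g.start] at h6
  rw [g.finish] at h7
  omega

lemma Geodesic.exists_min_height {x y : List ℕ} (g : Geodesic (causalGraph t) x y) :
    ∃ m ≤ g.length, ∀ i ≤ g.length, (g.vert m).length ≤ (g.vert i).length := by
  obtain ⟨m, hm, h⟩ := Finset.exists_min_image (Finset.Icc 0 g.length)
    (fun i => (g.vert i).length) ⟨0, by simp⟩
  exact ⟨m, by simpa using hm, fun i hi => h i (by simpa using hi)⟩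

end Causal

/-! ### Rays and flows on a plane tree -/

/-- An infinite ray of a plane tree, started at the root. -/
structure IsRay (t : PlaneTree) (w : ℕ → List ℕ) : Prop where
  zero : w 0 = []
  succ : ∀ n, ∃ i, w (n + 1) = w n ++ [i]
  mem : ∀ n, w n ∈ t.verts

lemma IsRay.length {t : PlaneTree} {w : ℕ → List ℕ} (hw : IsRay t w) (n : ℕ) :
    (w n).length = n := by
  induction n with
  | zero => simp [hw.zero]
  | succ n ih =>
    obtain ⟨i, hi⟩ := hw.succ n
    simp [hi, ih]

lemma IsRay.take {t : PlaneTree} {w : ℕ → List ℕ} (hw : IsRay t w) {m n : ℕ} (h : m ≤ n) :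
    (w n).take m = w m := by
  induction n, h using Nat.le_induction with
  | base => exact List.take_of_length_le (hw.length m).le
  | succ n h ih =>
    obtain ⟨i, hi⟩ := hw.succ n
    rw [hi, List.take_append_of_le_length (by rw [hw.length]; exact h), ih]

/-- A unit flow from the root to infinity in a plane tree: a nonnegative function `ν` on the
vertices, whose value at a vertex is the sum of its values at the children. It is defined on all
words, and vanishes at those which are not vertices. -/
structure IsFlow (t : PlaneTree) (ν : List ℕ → ℝ≥0∞) : Prop where
  root : ν [] = 1
  split : ∀ u, ν u = ∑' i, ν (u ++ [i])
  mem : ∀ u, ν u ≠ 0 → u ∈ t.verts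

/-- The flow through a vertex at height `h` is `o(1 / h)`, uniformly in the vertex. -/
def IsThin (ν : List ℕ → ℝ≥0∞) : Prop :=
  ∀ ε ≠ 0, ∃ k : ℕ, ∀ u : List ℕ, k ≤ u.length → ((2 * u.length + 2 : ℕ) : ℝ≥0∞) * ν u ≤ ε

lemma IsFlow.exists_child {t : PlaneTree} {ν : List ℕ → ℝ≥0∞} (hν : IsFlow t ν)
    (B : Finset (List ℕ)) (u : List ℕ)
    (h : ∑ b ∈ B, (if u <+: b then ν b else 0) < ν u) :
    ∃ i, ∑ b ∈ B, (if u ++ [i] <+: b then ν b else 0) < ν (u ++ [i]) := by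
  by_contra! hc
  refine h.not_ge ?_
  calc ν u = ∑' i, ν (u ++ [i]) := hν.split u
    _ ≤ ∑' i, ∑ b ∈ B, (if u ++ [i] <+: b then ν b else 0) := ENNReal.tsum_le_tsum hc
    _ = ∑ b ∈ B, ∑' i, (if u ++ [i] <+: b then ν b else 0) :=
        Summable.tsum_finsetSum fun _ _ => ENNReal.summable
    _ ≤ ∑ b ∈ B, (if u <+: b then ν b else 0) := by
        refine Finset.sum_le_sum fun b _ => ?_
        by_cases hb : ∃ i, u ++ [i] <+: b
        · obtain ⟨i, hi⟩ := hb
          rw [tsum_eq_single i, if_pos hi, if_pos ((List.prefix_append _ _).trans hi)]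
          intro j hj
          refine if_neg fun hj' => hj ?_
          have := List.prefix_of_prefix_length_le hj' hi (by simp)
          simpa using this.eq_of_length (by simp)
        · simp only [not_exists] at hb
          simp [hb]

/-- If a finite set `B` carries less flow than the vertex `u`, then some ray through `u` does not
meet `B` after `u`. -/
lemma IsFlow.exists_ray {t : PlaneTree} {ν : List ℕ → ℝ≥0∞} (hν : IsFlow t ν)
    (B : Finset (List ℕ)) (u : List ℕ) (h : ∑ b ∈ B, ν b < ν u) :
    ∃ w, IsRay t w ∧ w u.length = u ∧ ∀ n, u.length ≤ n → w n ∉ B ∧ ν (w n) ≠ 0 := by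
  let S := {v : List ℕ // ∑ b ∈ B, (if v <+: b then ν b else 0) < ν v}
  have hu : ∑ b ∈ B, (if u <+: b then ν b else 0) < ν u := by
    refine lt_of_le_of_lt (Finset.sum_le_sum fun b _ => ?_) h
    split_ifs <;> simp
  choose c hc using fun v : S => hν.exists_child B v.1 v.2
  let f : ℕ → S := fun n => Nat.rec ⟨u, hu⟩ (fun _ v => ⟨v.1 ++ [c v], hc v⟩) n
  have hf : ∀ n, (f (n + 1)).1 = (f n).1 ++ [c (f n)] := fun n => rfl
  have hf0 : (f 0).1 = u := rfl
  have hpos : ∀ v : S, ν v.1 ≠ 0 := fun v => (pos_of_gt v.2).ne'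
  have hB : ∀ v : S, v.1 ∉ B := by
    intro v hv
    refine v.2.not_ge ?_
    have := Finset.single_le_sum (f := fun b => if v.1 <+: b then ν b else 0)
      (fun _ _ => zero_le) hv
    simpa using this
  let w : ℕ → List ℕ := fun n => if n < u.length then u.take n else (f (n - u.length)).1
  have hw : ∀ n, u.length ≤ n → w n = (f (n - u.length)).1 := fun n hn => if_neg (by omega)
  refine ⟨w, ⟨?_, fun n => ?_, fun n => ?_⟩, ?_, fun n hn => ?_⟩
  · rcases Nat.eq_zero_or_pos u.length with h0 | h0
    · rw [hw 0 (by omega), Nat.zero_sub]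
      exact List.length_eq_zero_iff.1 h0
    · simp [w, h0]
  · rcases lt_or_ge n u.length with h1 | h1
    · have h2 : w n = u.take n := if_pos h1
      rw [h2]
      refine ⟨u[n], ?_⟩
      rw [List.take_concat_get' u n h1]
      rcases lt_or_ge (n + 1) u.length with h3 | h3
      · exact if_pos h3
      · rw [hw _ h3, show n + 1 = u.length by omega, Nat.sub_self, List.take_length, hf0]
    · rw [hw n h1, hw (n + 1) (by omega), show n + 1 - u.length = n - u.length + 1 by omega]
      exact ⟨_, hf _⟩
  · rcases lt_or_ge n u.length with h1 | h1
    · have h2 : w n = u.take n := if_pos h1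
      rw [h2]
      exact take_mem (hν.mem _ (pos_of_gt hu).ne') n
    · rw [hw n h1]
      exact hν.mem _ (hpos _)
  · rw [hw _ le_rfl, Nat.sub_self, hf0]
  · rw [hw n hn]
    exact ⟨hB _, hpos _⟩

/-- A geodesic which stays high is cut from the ends of the tree by a finite set which carries
little flow, namely its ancestors at the least height it reaches. -/
lemma Geodesic.exists_cutset {t : PlaneTree} {ν : List ℕ → ℝ≥0∞} {ε : ℝ≥0∞} {k : ℕ}
    (hk : ∀ u : List ℕ, k ≤ u.length → ((2 * u.length + 2 : ℕ) : ℝ≥0∞) * ν u ≤ ε)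
    {x y : List ℕ} (g : Geodesic (causalGraph t) x y) (hg : ∀ v ∈ g.vertices, k ≤ v.length) :
    ∃ B : Finset (List ℕ), ∑ b ∈ B, ν b ≤ ε ∧
      ∀ w, IsRay t w → (∀ n, k ≤ n → w n ∉ B) → ∀ n, w n ∉ g.vertices := by
  obtain ⟨m, hm, hmin⟩ := g.exists_min_height
  set h := (g.vert m).length with hh
  have hkh : k ≤ h := hg _ ⟨m, hm, rfl⟩
  refine ⟨g.ancestors h, ?_, fun w hw hB n hn => ?_⟩
  · have h1 : ∀ b ∈ g.ancestors h, ν b ≤ ε / ((2 * h + 2 : ℕ) : ℝ≥0∞) := by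
      intro b hb
      obtain ⟨j, hj, rfl⟩ := Finset.mem_image.1 hb
      have hl : ((g.vert j).take h).length = h := by
        have := hmin j (Finset.mem_Icc.1 hj).2
        simp only [List.length_take]
        omega
      have h2 := hk ((g.vert j).take h) (by omega)
      rw [hl, mul_comm] at h2
      exact (ENNReal.le_div_iff_mul_le (Or.inl (by simp)) (Or.inl (by finiteness))).2 h2
    have h3 := Finset.sum_le_card_nsmul _ _ _ h1
    refine h3.trans ?_
    rw [nsmul_eq_mul]
    refine le_trans ?_ (ENNReal.mul_div_le (a := ((2 * h + 2 : ℕ) : ℝ≥0∞)))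
    gcongr
    exact g.card_ancestors_le hmin hm rfl
  · obtain ⟨j, hj, hjn⟩ := hn
    have h1 : n = (g.vert j).length := by rw [hjn, hw.length]
    have h2 := hmin j hj
    refine hB h hkh ?_
    rw [← hw.take (show h ≤ n by omega), ← hjn]
    exact g.mem_ancestors h hj

/-! ### Geodesic triangles surrounding the root -/

section Topology

variable {t : PlaneTree} {w : ℕ → List ℕ}

/-- The subset of the plane covered by the drawing of a ray. -/
def rayCurve (t : PlaneTree) (w : ℕ → List ℕ) : Set ℂ :=
  ⋃ n, causalArc t (.tree (w (n + 1))) '' Set.Icc 0 1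

lemma IsRay.causalArrow (hw : IsRay t w) (n : ℕ) :
    CausalArrow t (.tree (w (n + 1))) (w n) (w (n + 1)) := by
  obtain ⟨i, hi⟩ := hw.succ n
  exact ⟨hw.mem _, by simp [hi], by simp [hi], rfl⟩

lemma IsRay.isPreconnected_rayCurve (hw : IsRay t w) : IsPreconnected (rayCurve t w) := by
  refine IsPreconnected.iUnion_of_chain (fun n => ?_) fun n => ?_
  · refine isPreconnected_Icc.image _ ?_
    exact (causalMap t).arc_continuous (.tree (w (n + 1))) ⟨_, _, Or.inl (hw.causalArrow n)⟩
  · refine ⟨polar (w (n + 1)).length (angle t (w (n + 1))), ⟨1, by simp, ?_⟩, ⟨0, by simp, ?_⟩⟩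
    · exact (arrow_ends (hw.causalArrow n)).2
    · exact (arrow_ends (hw.causalArrow (n + 1))).1

lemma IsRay.root_mem_rayCurve (hw : IsRay t w) :
    (causalMap t).pos (causalMap t).root ∈ rayCurve t w := by
  refine Set.mem_iUnion.2 ⟨0, 0, by simp, ?_⟩
  rw [(arrow_ends (hw.causalArrow 0)).1, hw.zero]
  rfl

lemma IsRay.not_isBounded_rayCurve (hw : IsRay t w) : ¬ Bornology.IsBounded (rayCurve t w) := by
  intro h
  obtain ⟨R, hR⟩ := h.exists_norm_le
  obtain ⟨n, hn⟩ := exists_nat_gt R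
  have h1 := hR (polar (w (n + 1)).length (angle t (w (n + 1))))
    (Set.mem_iUnion.2 ⟨n, 1, by simp, (arrow_ends (hw.causalArrow n)).2⟩)
  rw [norm_polar (by positivity), hw.length] at h1
  push_cast at h1
  linarith

/-- In the drawing, a ray which shares no vertex with a geodesic does not meet it at all. -/
lemma IsRay.disjoint_trace (hw : IsRay t w) {x y : List ℕ} (g : Geodesic (causalGraph t) x y)
    (hg : ∀ n, w n ∉ g.vertices) : Disjoint (rayCurve t w) ((causalMap t).trace g) := by
  have hlink := fun n => (Or.inl (hw.causalArrow n) :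
    (causalMap t).graph.IsLink (.tree (w (n + 1))) (w n) (w (n + 1)))
  have hvert : ∀ z ∈ rayCurve t w, ∀ v ∈ g.vertices, z ≠ (causalMap t).pos v := by
    rintro z hz v hv rfl
    obtain ⟨n, s, hs, hz⟩ := Set.mem_iUnion.1 hz
    have hmem : v ∈ (causalMap t).graph.vertexSet := by
      obtain ⟨i, hi, rfl⟩ := hv
      exact g.isWalk.mem hi
    obtain ⟨h0, h1⟩ := arrow_ends (hw.causalArrow n)
    rcases Set.eq_endpoints_or_mem_Ioo_of_mem_Icc hs with rfl | rfl | hs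
    · rw [h0] at hz
      exact hg n ((causalMap t).pos_injOn (hw.mem n) hmem hz ▸ hv)
    · rw [h1] at hz
      exact hg (n + 1) ((causalMap t).pos_injOn (hw.mem _) hmem hz ▸ hv)
    · exact (causalMap t).arc_ne_pos _ ⟨_, _, hlink n⟩ s hs v hmem hz
  rw [Set.disjoint_left]
  rintro z hz (⟨i, hi, rfl⟩ | ⟨i, hi, s', hs', rfl⟩)
  · exact hvert _ hz _ ⟨i, hi, rfl⟩ rfl
  have hl := g.isWalk.2 i hi
  have hv : g.vert i ∈ g.vertices := ⟨i, hi.le, rfl⟩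
  have hv' : g.vert (i + 1) ∈ g.vertices := ⟨i + 1, hi, rfl⟩
  have he := (causalMap t).arc_ends _ _ _ hl
  rcases Set.eq_endpoints_or_mem_Ioo_of_mem_Icc hs' with rfl | rfl | hs'
  · rcases he with he | he
    · exact hvert _ hz _ hv he.1
    · exact hvert _ hz _ hv' he.1
  · rcases he with he | he
    · exact hvert _ hz _ hv' he.2
    · exact hvert _ hz _ hv he.2
  obtain ⟨n, s, hs, hz⟩ := Set.mem_iUnion.1 hz
  obtain ⟨h0, h1⟩ := arrow_ends (hw.causalArrow n)
  have hne := (causalMap t).arc_ne_pos _ ⟨_, _, hl⟩ s' hs'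
  rcases Set.eq_endpoints_or_mem_Ioo_of_mem_Icc hs with rfl | rfl | hs
  · exact hne (w n) (hw.mem n) (hz.symm.trans h0)
  · exact hne (w (n + 1)) (hw.mem _) (hz.symm.trans h1)
  · by_cases hee : CausalEdge.tree (w (n + 1)) = g.edge i
    · rw [← hee] at hl
      rcases (causalMap t).graph.eq_or_eq_of_isLink_of_isLink (hlink n).symm hl with h | h
      · exact hg (n + 1) (h ▸ hv)
      · exact hg (n + 1) (h ▸ hv')
    · exact (causalMap t).arc_disjoint _ ⟨_, _, hlink n⟩ _ ⟨_, _, hl⟩ hee s hs s' hs' hz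

/-- A set which surrounds the root meets every ray. -/
lemma IsRay.not_surrounds (hw : IsRay t w) {K : Set ℂ} (hK : Disjoint (rayCurve t w) K) :
    ¬ Surrounds K ((causalMap t).pos (causalMap t).root) := fun h =>
  hw.not_isBounded_rayCurve <| h.subset <|
    hw.isPreconnected_rayCurve.subset_connectedComponentIn hw.root_mem_rayCurve
      (Set.subset_compl_iff_disjoint_right.2 hK)

end Topology

theorem IsFlow.weaklyAnchoredHyperbolic {t : PlaneTree} {ν : List ℕ → ℝ≥0∞} (hν : IsFlow t ν)
    (hthin : IsThin ν) : (causalMap t).WeaklyAnchoredHyperbolic := by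
  -- Three cutsets, each with flow at most `1 / 4`, do not carry the whole flow.
  obtain ⟨k, hk⟩ := hthin 4⁻¹ (by simp)
  refine ⟨k, fun x y z g₁ g₂ g₃ hs => ?_⟩
  by_contra! hfar
  have hh : ∀ {x y : List ℕ} (g : Geodesic (causalGraph t) x y),
      g.vertices ⊆ g₁.vertices ∪ g₂.vertices ∪ g₃.vertices → ∀ v ∈ g.vertices, k ≤ v.length := by
    intro x y g hsub v hv
    have h1 := hfar v (hsub hv)
    have hmem : v ∈ t.verts := by
      obtain ⟨i, hi, rfl⟩ := hv
      exact g.isWalk.mem hi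
    have h2 := h1.trans_le (reach_root hmem).graphDist_le
    exact_mod_cast h2.le
  obtain ⟨B₁, hB₁, hr₁⟩ := g₁.exists_cutset hk (hh g₁ fun _ h => Or.inl (Or.inl h))
  obtain ⟨B₂, hB₂, hr₂⟩ := g₂.exists_cutset hk (hh g₂ fun _ h => Or.inl (Or.inr h))
  obtain ⟨B₃, hB₃, hr₃⟩ := g₃.exists_cutset hk (hh g₃ fun _ h => Or.inr h)
  have hB : ∑ b ∈ B₁ ∪ B₂ ∪ B₃, ν b < ν [] := by
    have h4 : (4⁻¹ + 4⁻¹ + 4⁻¹ : ℝ≥0∞) < 1 := by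
      rw [← ENNReal.toReal_lt_toReal (by simp) (by simp)]
      rw [ENNReal.toReal_add (by simp) (by simp), ENNReal.toReal_add (by simp) (by simp)]
      norm_num
    rw [hν.root]
    refine lt_of_le_of_lt ?_ h4
    have hun : ∀ A B : Finset (List ℕ), ∑ b ∈ A ∪ B, ν b ≤ ∑ b ∈ A, ν b + ∑ b ∈ B, ν b := by
      intro A B
      rw [← Finset.sum_union_inter]
      exact le_self_add
    calc _ ≤ _ := hun _ _
      _ ≤ (∑ b ∈ B₁, ν b + ∑ b ∈ B₂, ν b) + ∑ b ∈ B₃, ν b := by gcongr; exact hun _ _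
      _ ≤ _ := by gcongr
  obtain ⟨w, hw, -, hav⟩ := hν.exists_ray _ _ hB
  have hav' := fun n => (hav n (Nat.zero_le _)).1
  simp only [Finset.mem_union, not_or] at hav'
  refine hw.not_surrounds (K := (causalMap t).trace g₁ ∪ (causalMap t).trace g₂ ∪
    (causalMap t).trace g₃) ?_ hs
  refine Disjoint.union_right (Disjoint.union_right ?_ ?_) ?_
  · exact hw.disjoint_trace _ (hr₁ w hw fun n _ => (hav' n).1.1)
  · exact hw.disjoint_trace _ (hr₂ w hw fun n _ => (hav' n).1.2)
  · exact hw.disjoint_trace _ (hr₃ w hw fun n _ => (hav' n).2)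

/-! ### Bi-infinite geodesics -/

lemma append_lt_append_of_length_eq : ∀ {p q : List ℕ}, p.length = q.length → p < q →
    ∀ x y : List ℕ, p ++ x < q ++ y
  | [], [], _, h, _, _ => absurd h (lt_irrefl _)
  | [], _ :: _, hl, _, _, _ => by simp at hl
  | _ :: _, [], hl, _, _, _ => by simp at hl
  | a :: p, b :: q, hl, h, x, y => by
    rcases List.cons_lt_cons_iff.1 h with h1 | ⟨rfl, h1⟩
    · exact List.cons_lt_cons_iff.2 (Or.inl h1)
    · exact List.cons_lt_cons_iff.2
        (Or.inr ⟨rfl, append_lt_append_of_length_eq (by simpa using hl) h1 x y⟩)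

lemma PlaneTree.rank_lt_rank_iff {t : PlaneTree} {v w : List ℕ} (hv : v ∈ t.verts)
    (hw : w ∈ t.verts) (hl : v.length = w.length) : t.rank v < t.rank w ↔ v < w := by
  refine ⟨fun h => ?_, t.rank_lt_rank hv hl⟩
  by_contra hc
  rcases (not_lt.1 hc).lt_or_eq with h1 | h1
  · exact h.not_gt (t.rank_lt_rank hw hl.symm h1)
  · exact h.ne (by rw [h1])

section Separation

variable {t : PlaneTree} {a b : ℕ → List ℕ}

/-- The vertex `v` lies strictly between the rays `a` and `b`. -/
def Between (a b : ℕ → List ℕ) (v : List ℕ) : Prop :=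
  a v.length < v ∧ v < b v.length

lemma IsRay.lt_append_iff (ha : IsRay t a) {p : List ℕ} (hp : p ≠ a p.length) (i : ℕ) :
    (a (p ++ [i]).length < p ++ [i] ↔ a p.length < p) ∧
      (p ++ [i] < a (p ++ [i]).length ↔ p < a p.length) := by
  obtain ⟨j, hj⟩ := ha.succ p.length
  have hl : (a p.length).length = p.length := ha.length _
  have h1 : (p ++ [i]).length = p.length + 1 := by simp
  rw [h1, hj]
  refine ⟨⟨fun h => ?_, fun h => append_lt_append_of_length_eq hl h _ _⟩,
    ⟨fun h => ?_, fun h => append_lt_append_of_length_eq hl.symm h _ _⟩⟩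
  · exact (lt_or_eq_of_append_lt hl h).resolve_right hp.symm
  · exact (lt_or_eq_of_append_lt hl.symm h).resolve_right hp

lemma between_append_iff (ha : IsRay t a) (hb : IsRay t b) {p : List ℕ} (hpa : p ≠ a p.length)
    (hpb : p ≠ b p.length) (i : ℕ) : Between a b (p ++ [i]) ↔ Between a b p :=
  and_congr (ha.lt_append_iff hpa i).1 (hb.lt_append_iff hpb i).2

lemma between_iff_rank (ha : IsRay t a) (hb : IsRay t b) {v : List ℕ} (hv : v ∈ t.verts) :
    Between a b v ↔ t.rank (a v.length) < t.rank v ∧ t.rank v < t.rank (b v.length) :=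
  and_congr (PlaneTree.rank_lt_rank_iff (ha.mem _) hv (ha.length _)).symm
    (PlaneTree.rank_lt_rank_iff hv (hb.mem _) (hb.length _).symm).symm

lemma between_iff_of_isNext (ha : IsRay t a) (hb : IsRay t b) {v w : List ℕ} (h : t.IsNext v w)
    (hva : v ≠ a v.length) (hwb : w ≠ b w.length) : Between a b v ↔ Between a b w := by
  obtain ⟨hv, ⟨hw, hl⟩, hr⟩ := h
  rw [between_iff_rank ha hb hv, between_iff_rank ha hb hw, hl]
  rw [hl] at hwb
  have h1 : t.rank v ≠ t.rank (a v.length) := fun h =>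
    hva (t.rank_inj hv (ha.mem _) (ha.length _).symm h)
  have h2 : t.rank w ≠ t.rank (b v.length) := fun h =>
    hwb (t.rank_inj hw (hb.mem _) (by rw [hl, hb.length]) h)
  have h3 := t.rank_lt_levelCard (hb.mem v.length)
  rw [hb.length] at h3
  have h4 := t.rank_lt_levelCard hv
  rcases Nat.lt_or_ge (t.rank v + 1) (t.levelCard v.length) with h5 | h5
  · rw [Nat.mod_eq_of_lt h5] at hr
    omega
  · rw [show t.rank v + 1 = t.levelCard v.length by omega, Nat.mod_self] at hr
    omega

/-- Two rays separate the map: a walk which does not meet them stays on the same side. -/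
lemma IsWalk.between_iff (ha : IsRay t a) (hb : IsRay t b) {n : ℕ} {p : ℕ → List ℕ}
    {e : ℕ → CausalEdge} (hw : IsWalk (causalGraph t) n p e) (hpa : ∀ i ≤ n, ∀ m, p i ≠ a m)
    (hpb : ∀ i ≤ n, ∀ m, p i ≠ b m) : Between a b (p 0) ↔ Between a b (p n) := by
  have key : ∀ i ≤ n, (Between a b (p 0) ↔ Between a b (p i)) := by
    intro i
    induction i with
    | zero => exact fun _ => Iff.rfl
    | succ i ih =>
      intro hi
      have hi' : i ≤ n := by omega
      refine (ih hi').trans ?_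
      rcases isLink_cases (hw.2 i (by omega)) with ⟨j, hj⟩ | ⟨j, hj⟩ | ⟨-, -, h | h⟩
      · rw [hj]
        exact (between_append_iff ha hb (hpa _ hi' _) (hpb _ hi' _) j).symm
      · rw [hj]
        exact between_append_iff ha hb (hpa _ hi _) (hpb _ hi _) j
      · exact between_iff_of_isNext ha hb h (hpa _ hi' _) (hpb _ hi _)
      · exact (between_iff_of_isNext ha hb h (hpa _ hi _) (hpb _ hi' _)).symm
  exact key n le_rfl

lemma IsRay.lt_of_lt {w : ℕ → List ℕ} (ha : IsRay t a) (hw : IsRay t w) {m n : ℕ} (hmn : m ≤ n)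
    (h : a m < w m) : a n < w n := by
  rw [← List.take_append_drop m (a n), ← List.take_append_drop m (w n), ha.take hmn, hw.take hmn]
  exact append_lt_append_of_length_eq (by rw [ha.length, hw.length]) h _ _

end Separation

/-- A thin flow is spread over at least four vertices of some level. -/
lemma IsFlow.exists_four {t : PlaneTree} {ν : List ℕ → ℝ≥0∞} (hν : IsFlow t ν)
    (hthin : IsThin ν) : ∃ (h : ℕ) (u : Fin 4 → List ℕ), StrictMono u ∧
      ∀ i, (u i).length = h ∧ ν (u i) ≠ 0 := by
  -- Any constant less than `1 / 3` does: then three vertices of the level do not carry the flow.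
  obtain ⟨h, hk⟩ := hthin 8⁻¹ (by simp)
  have hle : ∀ u : List ℕ, u.length = h → ν u ≤ 8⁻¹ := by
    intro u hu
    refine le_trans ?_ (hk u hu.ge)
    refine le_mul_of_one_le_left zero_le ?_
    exact_mod_cast (by omega : 1 ≤ 2 * u.length + 2)
  have key : ∀ m ≤ 4, ∃ B : Finset (List ℕ), B.card = m ∧
      ∀ b ∈ B, b.length = h ∧ ν b ≠ 0 := by
    intro m
    induction m with
    | zero => exact fun _ => ⟨∅, by simp⟩
    | succ m ih =>
      intro hm
      obtain ⟨B, hc, hB⟩ := ih (by omega)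
      have hlt : ∑ b ∈ B, ν b < ν [] := by
        rw [hν.root]
        refine lt_of_le_of_lt (Finset.sum_le_card_nsmul B ν 8⁻¹ fun b hb => hle b (hB b hb).1) ?_
        rw [hc, nsmul_eq_mul, ← div_eq_mul_inv]
        refine ENNReal.div_lt_of_lt_mul ?_
        rw [one_mul]
        exact_mod_cast (by omega : m < 8)
      obtain ⟨w, hw, -, hav⟩ := hν.exists_ray B [] hlt
      refine ⟨insert (w h) B, ?_, ?_⟩
      · rw [Finset.card_insert_of_notMem (hav h (Nat.zero_le _)).1, hc]
      · intro b hb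
        rcases Finset.mem_insert.1 hb with rfl | hb
        · exact ⟨hw.length h, (hav h (Nat.zero_le _)).2⟩
        · exact hB b hb
  obtain ⟨B, hc, hB⟩ := key 4 le_rfl
  exact ⟨h, B.orderEmbOfFin hc, (B.orderEmbOfFin hc).strictMono,
    fun i => hB _ (B.orderEmbOfFin_mem hc i)⟩

/-- There are two rays such that all the geodesics between them come close to the root: such a
geodesic has to meet all the rays of one of two subtrees, one on each side. -/
lemma IsFlow.exists_rays {t : PlaneTree} {ν : List ℕ → ℝ≥0∞} (hν : IsFlow t ν)
    (hthin : IsThin ν) : ∃ (k : ℕ) (r s : ℕ → List ℕ), IsRay t r ∧ IsRay t s ∧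
      ∀ n, k ≤ n → ∀ g : Geodesic (causalGraph t) (r n) (s n), ∃ v ∈ g.vertices, v.length ≤ k := by
  obtain ⟨h, u, hu, hpos⟩ := hν.exists_four hthin
  have hlt : ∀ {i j : Fin 4}, i < j → u i < u j := fun hij => hu hij
  obtain ⟨ε, hε0, hε⟩ := exists_between (lt_min (pos_iff_ne_zero.2 (hpos 1).2)
    (pos_iff_ne_zero.2 (hpos 3).2))
  obtain ⟨k, hk⟩ := hthin ε hε0.ne'
  have hray : ∀ i, ∃ w, IsRay t w ∧ w h = u i := by
    intro i
    obtain ⟨w, hw, hwu, -⟩ := hν.exists_ray ∅ (u i) (by simpa using pos_iff_ne_zero.2 (hpos i).2)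
    exact ⟨w, hw, by rwa [(hpos i).1] at hwu⟩
  obtain ⟨r, hr, hru⟩ := hray 0
  obtain ⟨s, hs, hsu⟩ := hray 2
  refine ⟨max h k, r, s, hr, hs, fun n hn g => ?_⟩
  by_contra! hfar
  obtain ⟨B, hB, hcut⟩ := g.exists_cutset (k := max h k)
    (fun v hv => hk v (le_of_max_le_right hv)) fun v hv => (hfar v hv).le
  have hav : ∀ i, ε < ν (u i) → ∃ w, IsRay t w ∧ w h = u i ∧ ∀ n, w n ∉ g.vertices := by
    intro i hi
    obtain ⟨w, hw, hwu, hwB⟩ := hν.exists_ray B (u i) (hB.trans_lt hi)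
    rw [(hpos i).1] at hwu hwB
    exact ⟨w, hw, hwu, hcut w hw fun m hm => (hwB m (le_of_max_le_left hm)).1⟩
  obtain ⟨a, ha, hau, hag⟩ := hav 1 (hε.trans_le (min_le_left _ _))
  obtain ⟨b, hb, hbu, hbg⟩ := hav 3 (hε.trans_le (min_le_right _ _))
  have hhn : h ≤ n := le_of_max_le_left hn
  have hbet := g.isWalk.between_iff ha hb (fun i hi m hm => hag m ⟨i, hi, hm⟩)
    (fun i hi m hm => hbg m ⟨i, hi, hm⟩)
  rw [g.start, g.finish] at hbet
  have h1 : Between a b (s n) := by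
    rw [Between, hs.length]
    exact ⟨ha.lt_of_lt hs hhn (by rw [hau, hsu]; exact hlt (by decide)),
      hs.lt_of_lt hb hhn (by rw [hbu, hsu]; exact hlt (by decide))⟩
  have h2 := (hbet.2 h1).1
  rw [hr.length] at h2
  exact h2.not_gt (hr.lt_of_lt ha hhn (by rw [hau, hru]; exact hlt (by decide)))

/-- Compactness: geodesic segments which come close to the root and whose ends go to infinity
have a subsequential limit, which is a bi-infinite geodesic. -/
theorem exists_isBiinfiniteGeodesic {t : PlaneTree} {k : ℕ}
    (hseg : ∀ n, ∃ (x y : List ℕ) (g : Geodesic (causalGraph t) x y),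
      n ≤ x.length ∧ n ≤ y.length ∧ ∃ v ∈ g.vertices, v.length ≤ k) :
    ∃ γ : ℤ → List ℕ, IsBiinfiniteGeodesic (causalGraph t) γ := by
  choose x y g hx hy hv using hseg
  choose v hv hvk using hv
  choose m hm hmv using hv
  have hmk : ∀ n, ((g n).vert (m n)).length ≤ k := fun n => by rw [hmv]; exact hvk n
  have hm1 : ∀ n, n ≤ m n + k := by
    intro n
    have h1 := ((g n).isWalk.height_le (Nat.zero_le (m n)) (hm n)).1
    rw [(g n).start] at h1
    have := hx n
    have := hmk n
    omega
  have hm2 : ∀ n, n ≤ ((g n).length - m n) + k := by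
    intro n
    have h1 := ((g n).isWalk.height_le (hm n) le_rfl).2
    rw [(g n).finish] at h1
    have := hy n
    have := hmk n
    omega
  -- The segments are parametrized so that the vertex close to the root has index `0`.
  let p : ℕ → ℤ → List ℕ := fun n i => (g n).vert (m n + i).toNat
  have hp : ∀ (n : ℕ) (i : ℤ), i.natAbs + k ≤ n →
      p n i ∈ t.verts ∧ (p n i).length ≤ k + i.natAbs := by
    intro n i hi
    have h1 := hm1 n
    have h2 := hm2 n
    have h3 := hm n
    have h4 := hmk n
    have h5 : (m n + i).toNat ≤ (g n).length := by omega
    refine ⟨(g n).isWalk.mem h5, ?_⟩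
    change ((g n).vert (m n + i).toNat).length ≤ _
    rcases le_total (m n) (m n + i).toNat with h6 | h6
    · have := ((g n).isWalk.height_le h6 h5).2
      omega
    · have := ((g n).isWalk.height_le h6 h3).1
      omega
  have hdist : ∀ (n : ℕ) (i j : ℤ), i.natAbs + k ≤ n → j.natAbs + k ≤ n →
      graphDist (causalGraph t) (p n i) (p n j) = ((i - j).natAbs : ℕ∞) := by
    intro n i j hi hj
    have h1 := hm1 n
    have h2 := hm2 n
    have h3 := hm n
    rcases le_total i j with hij | hij
    · rw [(g n).graphDist_vert (by omega : (m n + i).toNat ≤ (m n + j).toNat) (by omega)]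
      congr 1
      omega
    · rw [graphDist_comm,
        (g n).graphDist_vert (by omega : (m n + j).toNat ≤ (m n + i).toNat) (by omega)]
      congr 1
      omega
  have hlarge : ∀ i : ℤ, ∀ᶠ n in (Filter.hyperfilter ℕ : Filter ℕ), i.natAbs + k ≤ n := by
    intro i
    refine Filter.Eventually.filter_mono (Nat.hyperfilter_le_atTop) ?_
    exact Filter.eventually_ge_atTop _
  -- Along an ultrafilter, a sequence with values in a finite set is eventually constant.
  have hlim : ∀ i : ℤ, ∃ v, ∀ᶠ n in (Filter.hyperfilter ℕ : Filter ℕ), p n i = v := by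
    intro i
    have hfin : {v | v ∈ t.verts ∧ v.length ≤ k + i.natAbs}.Finite := by
      have := finite_length_le t ((k + i.natAbs : ℕ) : ℝ)
      simpa only [Nat.cast_le] using this
    have h1 : ∀ᶠ n in (Filter.hyperfilter ℕ : Filter ℕ),
        ∃ v ∈ {v | v ∈ t.verts ∧ v.length ≤ k + i.natAbs}, p n i = v :=
      (hlarge i).mono fun n hn => ⟨_, hp n i hn, rfl⟩
    obtain ⟨v, -, hv⟩ := (Ultrafilter.eventually_exists_mem_iff hfin).1 h1
    exact ⟨v, hv⟩
  choose γ hγ using hlim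
  refine ⟨γ, fun i => ?_, fun i j => ?_⟩
  · obtain ⟨n, hn, hn'⟩ := ((hγ i).and (hlarge i)).exists
    exact hn ▸ (hp n i hn').1
  · obtain ⟨n, ⟨h1, h2⟩, h3, h4⟩ := (((hγ i).and (hγ j)).and ((hlarge i).and (hlarge j))).exists
    rw [← h1, ← h2]
    exact hdist n i j h3 h4

theorem IsFlow.exists_isBiinfiniteGeodesic {t : PlaneTree} {ν : List ℕ → ℝ≥0∞} (hν : IsFlow t ν)
    (hthin : IsThin ν) : ∃ γ : ℤ → List ℕ, IsBiinfiniteGeodesic (causalGraph t) γ := by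
  obtain ⟨k, r, s, hr, hs, h⟩ := hν.exists_rays hthin
  refine CausalMaps.exists_isBiinfiniteGeodesic (k := k) fun n => ?_
  obtain ⟨g⟩ := ((reach_root (hr.mem (n + k))).symm.trans
    (reach_root (hs.mem (n + k)))).exists_geodesic
  exact ⟨_, _, g, by rw [hr.length]; omega, by rw [hs.length]; omega, h (n + k) (by omega) g⟩

/-! ### Survival and the equally splitting flow -/

/-- The offspring numbers of the subtree of the child `i` of the root. -/
def subtree (i : ℕ) (c : List ℕ → ℕ) : List ℕ → ℕ := fun v => c (i :: v)

/-- The set of the offspring numbers for which the tree is infinite. -/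
def survSet : Set (List ℕ → ℕ) := {c | (PlaneTree.ofOffspring c).verts.Infinite}

/-- The set of the offspring numbers for which the root has a child `i`, whose subtree is
infinite. -/
def survChild (i : ℕ) : Set (List ℕ → ℕ) := {c | i < c [] ∧ subtree i c ∈ survSet}

/-- The number of children of the root whose subtree is infinite. -/
noncomputable def survDegree (c : List ℕ → ℕ) : ℝ≥0∞ := ∑' i, (survChild i).indicator 1 c

lemma cons_mem_verts {c : List ℕ → ℕ} {i : ℕ} {v : List ℕ} :
    i :: v ∈ (PlaneTree.ofOffspring c).verts ↔
      i < c [] ∧ v ∈ (PlaneTree.ofOffspring (subtree i c)).verts := by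
  constructor
  · intro h
    refine ⟨h [] i (by simp), fun p j hp => h (i :: p) j (by simpa using hp)⟩
  · rintro ⟨h1, h2⟩ p j hp
    cases p with
    | nil =>
      have : j = i := by simpa using hp
      exact this ▸ h1
    | cons a p =>
      obtain ⟨rfl, hp'⟩ := List.cons_prefix_cons.1 hp
      exact h2 p j hp'

lemma mem_survSet_iff {c : List ℕ → ℕ} : c ∈ survSet ↔ ∃ i, c ∈ survChild i := by
  have key : (PlaneTree.ofOffspring c).verts = {[]} ∪ ⋃ i ∈ Set.Iio (c []),
      (fun v => i :: v) '' (PlaneTree.ofOffspring (subtree i c)).verts := by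
    ext u
    cases u with
    | nil => simp [(PlaneTree.ofOffspring c).root_mem]
    | cons i v => simp [cons_mem_verts, and_comm]
  rw [← not_iff_not]
  simp only [survSet, survChild, Set.mem_ofPred_eq, not_exists, not_and, Set.not_infinite]
  rw [key, Set.finite_union]
  simp only [Set.finite_singleton, true_and]
  constructor
  · intro h i hi
    refine Set.Finite.of_finite_image (h.subset ?_) (List.cons_injective (a := i)).injOn
    exact Set.subset_biUnion_of_mem (u := fun i => (fun v => i :: v) ''
      (PlaneTree.ofOffspring (subtree i c)).verts) hi
  · exact fun h => (Set.finite_Iio _).biUnion fun i hi => (h i hi).image _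

lemma survDegree_ne_top (c : List ℕ → ℕ) : survDegree c ≠ ⊤ := by
  rw [survDegree, tsum_eq_sum (s := Finset.range (c []))]
  · refine (ENNReal.sum_lt_top.2 fun i _ => ?_).ne
    exact lt_of_le_of_lt (Set.indicator_le_self' (fun _ _ => zero_le) _) ENNReal.one_lt_top
  · intro i hi
    exact Set.indicator_of_notMem (fun h => hi (Finset.mem_range.2 h.1)) _

lemma survDegree_eq_zero {c : List ℕ → ℕ} (hc : c ∉ survSet) : survDegree c = 0 := by
  refine ENNReal.tsum_eq_zero.2 fun i => Set.indicator_of_notMem (fun h => hc ?_) _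
  exact mem_survSet_iff.2 ⟨i, h⟩

lemma one_le_survDegree {c : List ℕ → ℕ} (hc : c ∈ survSet) : 1 ≤ survDegree c := by
  obtain ⟨i, hi⟩ := mem_survSet_iff.1 hc
  calc (1 : ℝ≥0∞) = (survChild i).indicator 1 c := by simp [hi]
    _ ≤ survDegree c := ENNReal.le_tsum i

lemma tsum_survChild_const (c : List ℕ → ℕ) (a : ℝ≥0∞) :
    ∑' i, (survChild i).indicator (fun _ => a) c = a * survDegree c := by
  rw [survDegree, ← ENNReal.tsum_mul_left]
  refine tsum_congr fun i => ?_
  by_cases h : c ∈ survChild i <;> simp [h]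

/-- The flow which, at each vertex, is split equally among the children whose subtree is
infinite. It vanishes outside of the tree, and it vanishes identically if the tree is finite. -/
noncomputable def splitFlow : List ℕ → (List ℕ → ℕ) → ℝ≥0∞
  | [], c => survSet.indicator 1 c
  | i :: v, c => (survChild i).indicator (fun c => (survDegree c)⁻¹ * splitFlow v (subtree i c)) c

lemma splitFlow_split (u : List ℕ) (c : List ℕ → ℕ) :
    splitFlow u c = ∑' i, splitFlow (u ++ [i]) c := by
  induction u generalizing c with
  | nil =>
    have h1 : ∀ i, splitFlow ([] ++ [i]) c =
        (survChild i).indicator (fun _ => (survDegree c)⁻¹) c := by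
      intro i
      by_cases h : c ∈ survChild i
      · simp [splitFlow, h, h.2]
      · simp [splitFlow, h]
    simp_rw [h1]
    rw [tsum_survChild_const]
    by_cases h : c ∈ survSet
    · have h0 : survDegree c ≠ 0 := (zero_lt_one.trans_le (one_le_survDegree h)).ne'
      simp [splitFlow, h, ENNReal.inv_mul_cancel h0 (survDegree_ne_top c)]
    · simp [splitFlow, h, survDegree_eq_zero h]
  | cons j v ih =>
    simp only [List.cons_append, splitFlow]
    by_cases h : c ∈ survChild j
    · simp only [Set.indicator_of_mem h]
      rw [ENNReal.tsum_mul_left, ← ih]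
    · simp [h]

lemma mem_verts_of_splitFlow_ne_zero {u : List ℕ} {c : List ℕ → ℕ} (h : splitFlow u c ≠ 0) :
    u ∈ (PlaneTree.ofOffspring c).verts := by
  induction u generalizing c with
  | nil => exact (PlaneTree.ofOffspring c).root_mem
  | cons j v ih =>
    simp only [splitFlow] at h
    have h1 := Set.mem_of_indicator_ne_zero h
    rw [Set.indicator_of_mem h1] at h
    exact cons_mem_verts.2 ⟨h1.1, ih (right_ne_zero_of_mul h)⟩

lemma isFlow_splitFlow {c : List ℕ → ℕ} (hc : c ∈ survSet) :
    IsFlow (PlaneTree.ofOffspring c) (fun u => splitFlow u c) where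
  root := by simp [splitFlow, hc]
  split u := splitFlow_split u c
  mem _ h := mem_verts_of_splitFlow_ne_zero h

/-- The operator on functions of the tree which governs the energy `∑ ν(u) ^ 2` of the equally
splitting flow `ν` at successive heights. -/
noncomputable def energyStep (a : (List ℕ → ℕ) → ℝ≥0∞) (c : List ℕ → ℕ) : ℝ≥0∞ :=
  ∑' i, (survChild i).indicator (fun c => (survDegree c)⁻¹ ^ 2 * a (subtree i c)) c

/-- The energy of the equally splitting flow at height `n`, that is, the sum over the vertices `u`
at height `n` of the square of the flow through `u`. -/
noncomputable def flowEnergy : ℕ → (List ℕ → ℕ) → ℝ≥0∞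
  | 0 => survSet.indicator 1
  | n + 1 => energyStep (flowEnergy n)

lemma splitFlow_sq_le (u : List ℕ) (c : List ℕ → ℕ) :
    splitFlow u c ^ 2 ≤ flowEnergy u.length c := by
  induction u generalizing c with
  | nil => by_cases h : c ∈ survSet <;> simp [splitFlow, flowEnergy, h]
  | cons j v ih =>
    refine le_trans ?_ (ENNReal.le_tsum j)
    by_cases h : c ∈ survChild j
    · simp only [splitFlow, h, Set.indicator_of_mem, mul_pow]
      gcongr
      exact ih _
    · simp [splitFlow, h]

lemma flowEnergy_eq_zero (n : ℕ) {c : List ℕ → ℕ} (hc : c ∉ survSet) : flowEnergy n c = 0 := by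
  cases n with
  | zero => simp [flowEnergy, hc]
  | succ n =>
    refine ENNReal.tsum_eq_zero.2 fun i => Set.indicator_of_notMem (fun h => hc ?_) _
    exact mem_survSet_iff.2 ⟨i, h⟩

/-! ### Measurability -/

lemma measurable_subtree (i : ℕ) : Measurable (subtree i) :=
  measurable_pi_iff.2 fun v => measurable_pi_apply (i :: v)

lemma measurableSet_survSet : MeasurableSet survSet := by
  have h : survSet = ⋂ n : ℕ, ⋃ u ∈ {u : List ℕ | u.length = n},
      {c | u ∈ (PlaneTree.ofOffspring c).verts} := by
    ext c
    simp only [survSet, Set.mem_ofPred_eq, Set.mem_iInter, Set.mem_iUnion]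
    constructor
    · intro h n
      by_contra! hc
      refine h ((finite_length_le (PlaneTree.ofOffspring c) n).subset fun u hu => ⟨hu, ?_⟩)
      by_contra! hl
      have hl' : n < u.length := by exact_mod_cast hl
      exact hc (u.take n) (by simp; omega) (take_mem hu n)
    · intro h hfin
      obtain ⟨n, hn⟩ := (hfin.image List.length).bddAbove
      obtain ⟨u, hu, hu'⟩ := h (n + 1)
      have := hn ⟨u, hu', rfl⟩
      omega
  rw [h]
  refine MeasurableSet.iInter fun n => MeasurableSet.biUnion (Set.to_countable _) fun u _ => ?_
  have h2 : {c : List ℕ → ℕ | u ∈ (PlaneTree.ofOffspring c).verts} =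
      ⋂ p : List ℕ, ⋂ i : ℕ, ⋂ _ : (p ++ [i]) <+: u, {c | i < c p} := by
    ext c
    simp [PlaneTree.ofOffspring]
  rw [h2]
  refine MeasurableSet.iInter fun p => MeasurableSet.iInter fun i => MeasurableSet.iInter fun _ => ?_
  exact measurableSet_lt measurable_const (measurable_pi_apply p)

lemma measurableSet_survChild (i : ℕ) : MeasurableSet (survChild i) :=
  (measurableSet_lt measurable_const (measurable_pi_apply [])).inter
    (measurable_subtree i measurableSet_survSet)

lemma measurable_survDegree : Measurable survDegree :=
  Measurable.tsum fun i => measurable_one.indicator (measurableSet_survChild i)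

lemma measurable_energyStep {a : (List ℕ → ℕ) → ℝ≥0∞} (ha : Measurable a) :
    Measurable (energyStep a) :=
  Measurable.tsum fun i => ((measurable_survDegree.inv.pow_const 2).mul
    (ha.comp (measurable_subtree i))).indicator (measurableSet_survChild i)

lemma measurable_flowEnergy (n : ℕ) : Measurable (flowEnergy n) := by
  induction n with
  | zero => exact measurable_one.indicator measurableSet_survSet
  | succ n ih => exact measurable_energyStep ih

/-! ### Decay of the energy -/

section Law

variable (μ : PMF ℕ)

/-- The law of a family of independent offspring numbers with law `μ`. -/
noncomputable def offspringLaw : Measure (List ℕ → ℕ) := Measure.infinitePi fun _ => μ.toMeasure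

instance : IsProbabilityMeasure (offspringLaw μ) := by unfold offspringLaw; infer_instance

/-- The offspring numbers outside of the subtree of the child `i` of the root; those of
the subtree are replaced by `0`. -/
def eraseSubtree (i : ℕ) (c : List ℕ → ℕ) : List ℕ → ℕ := fun u => if [i] <+: u then 0 else c u

lemma eraseSubtree_nil (i : ℕ) (c : List ℕ → ℕ) : eraseSubtree i c [] = c [] := by
  simp [eraseSubtree]

lemma subtree_eraseSubtree {i j : ℕ} (h : j ≠ i) (c : List ℕ → ℕ) :
    subtree j (eraseSubtree i c) = subtree j c := by
  ext v
  simp [subtree, eraseSubtree, h.symm]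

lemma map_subtree (i : ℕ) : (offspringLaw μ).map (subtree i) = offspringLaw μ :=
  Measure.map_infinitePi_infinitePi_of_inj (P := fun _ : List ℕ => μ.toMeasure)
    (List.cons_injective (a := i))

/-- The subtree of a child of the root is independent of the rest of the tree. -/
lemma indepFun_subtree (i : ℕ) :
    IndepFun (eraseSubtree i) (subtree i) (offspringLaw μ) := by
  have hind : iIndepFun (fun (u : List ℕ) (c : List ℕ → ℕ) => c u) (offspringLaw μ) :=
    iIndepFun_infinitePi (P := fun _ : List ℕ => μ.toMeasure) (X := fun _ n => n)
      fun _ => measurable_id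
  have h := indep_iSup_of_disjoint (S := {u : List ℕ | ¬ [i] <+: u})
    (T := {u : List ℕ | [i] <+: u}) (fun u => (measurable_pi_apply u).comap_le)
    ((iIndepFun_iff_iIndep _ _ _).1 hind) (Set.disjoint_left.2 fun u h h' => h h')
  refine (IndepFun_iff_Indep _ _ _).2 (indep_of_indep_of_le h ?_ ?_)
  · refine Measurable.comap_le (@measurable_pi_lambda _ _ _ (_) _ _ fun u => ?_)
    by_cases hu : [i] <+: u
    · simp only [eraseSubtree, hu, if_true]
      exact measurable_const
    · simp only [eraseSubtree, hu, if_false]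
      refine Measurable.of_comap_le ?_
      exact le_iSup₂_of_le (f := fun (v : List ℕ) (_ : v ∈ {u : List ℕ | ¬ [i] <+: u}) =>
        MeasurableSpace.comap (fun c : List ℕ → ℕ => c v) inferInstance) u hu le_rfl
  · refine Measurable.comap_le (@measurable_pi_lambda _ _ _ (_) _ _ fun u =>
      Measurable.of_comap_le ?_)
    exact le_iSup₂_of_le (f := fun (v : List ℕ) (_ : v ∈ {u : List ℕ | [i] <+: u}) =>
        MeasurableSpace.comap (fun c : List ℕ → ℕ => c v) inferInstance) (i :: u)
        (by simp) le_rfl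

lemma lintegral_mul_subtree {i : ℕ} {f a : (List ℕ → ℕ) → ℝ≥0∞} (hf : Measurable f)
    (hfe : ∀ c, f (eraseSubtree i c) = f c) (ha : Measurable a) :
    ∫⁻ c, f c * a (subtree i c) ∂offspringLaw μ =
      (∫⁻ c, f c ∂offspringLaw μ) * ∫⁻ c, a c ∂offspringLaw μ := by
  have h := lintegral_mul_eq_lintegral_mul_lintegral_of_indepFun (f := fun c => f c)
    (g := a ∘ subtree i) hf (ha.comp (measurable_subtree i)) (by
      have := (indepFun_subtree μ i).comp hf ha
      rwa [show f ∘ eraseSubtree i = fun c => f c from funext hfe] at this)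
  rw [← map_subtree μ i, lintegral_map ha (measurable_subtree i), map_subtree μ i]
  exact h

/-- The factor of `a (subtree i c)` in `energyStep a c`, when `a` vanishes on finite trees. It
depends only on the offspring numbers outside of the subtree of `i`: as this subtree may be taken
to be infinite, it counts for `1` in the denominator. -/
noncomputable def childWeight (i : ℕ) (c : List ℕ → ℕ) : ℝ≥0∞ :=
  {c : List ℕ → ℕ | i < c []}.indicator
    (fun c => (1 + ∑' j, if j = i then 0 else (survChild j).indicator 1 c)⁻¹ ^ 2) c

lemma measurable_childWeight (i : ℕ) : Measurable (childWeight i) := by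
  refine Measurable.indicator ?_ (measurableSet_lt measurable_const (measurable_pi_apply []))
  have h : ∀ j, Measurable fun c : List ℕ → ℕ =>
      if j = i then (0 : ℝ≥0∞) else (survChild j).indicator 1 c := by
    intro j
    split_ifs
    · exact measurable_const
    · exact measurable_one.indicator (measurableSet_survChild j)
  exact ((measurable_const.add (Measurable.tsum h)).inv).pow_const 2

lemma eraseSubtree_mem_survChild {i j : ℕ} (h : j ≠ i) {c : List ℕ → ℕ} :
    eraseSubtree i c ∈ survChild j ↔ c ∈ survChild j := by
  simp only [survChild, Set.mem_ofPred_eq, eraseSubtree_nil, subtree_eraseSubtree h]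

lemma childWeight_eraseSubtree (i : ℕ) (c : List ℕ → ℕ) :
    childWeight i (eraseSubtree i c) = childWeight i c := by
  have h : ∀ j, (if j = i then 0 else
        (survChild j).indicator (1 : (List ℕ → ℕ) → ℝ≥0∞) (eraseSubtree i c)) =
      if j = i then 0 else (survChild j).indicator 1 c := by
    intro j
    by_cases hj : j = i
    · simp [hj]
    · by_cases hc : c ∈ survChild j <;> simp [hj, hc, eraseSubtree_mem_survChild hj]
  by_cases hi : i < c []
  · rw [childWeight, childWeight, Set.indicator_of_mem (by simpa [eraseSubtree_nil] using hi),
      Set.indicator_of_mem (by simpa using hi)]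
    simp_rw [h]
  · rw [childWeight, childWeight, Set.indicator_of_notMem (by simpa [eraseSubtree_nil] using hi),
      Set.indicator_of_notMem (by simpa using hi)]

lemma energyStep_eq {a : (List ℕ → ℕ) → ℝ≥0∞} (ha : ∀ c ∉ survSet, a c = 0) (c : List ℕ → ℕ) :
    energyStep a c = ∑' i, childWeight i c * a (subtree i c) := by
  refine tsum_congr fun i => ?_
  by_cases h : c ∈ survChild i
  · have hc : c ∈ {c : List ℕ → ℕ | i < c []} := h.1
    rw [Set.indicator_of_mem h, childWeight, Set.indicator_of_mem hc]
    congr 3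
    rw [survDegree, ENNReal.tsum_eq_add_tsum_ite i, Set.indicator_of_mem h, Pi.one_apply]
    refine congrArg _ (tsum_congr fun j => ?_)
    by_cases hj : j = i <;> simp [hj]
  · rw [Set.indicator_of_notMem h]
    by_cases hi : i < c []
    · rw [ha _ fun hs => h ⟨hi, hs⟩, mul_zero]
    · rw [childWeight, Set.indicator_of_notMem (by simpa using hi), zero_mul]

/-- The factor by which the mean energy of the equally splitting flow decreases at each step. -/
noncomputable def energyFactor : ℝ≥0∞ := ∑' i, ∫⁻ c, childWeight i c ∂offspringLaw μ

lemma lintegral_energyStep {a : (List ℕ → ℕ) → ℝ≥0∞} (ham : Measurable a)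
    (ha : ∀ c ∉ survSet, a c = 0) :
    ∫⁻ c, energyStep a c ∂offspringLaw μ = energyFactor μ * ∫⁻ c, a c ∂offspringLaw μ := by
  simp_rw [energyStep_eq ha]
  have hm : ∀ i, Measurable fun c => childWeight i c * a (subtree i c) := fun i =>
    (measurable_childWeight i).mul (ham.comp (measurable_subtree i))
  rw [lintegral_tsum fun i => (hm i).aemeasurable, energyFactor, ← ENNReal.tsum_mul_right]
  exact tsum_congr fun i =>
    lintegral_mul_subtree μ (measurable_childWeight i) (childWeight_eraseSubtree i) ham

lemma lintegral_flowEnergy (n : ℕ) :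
    ∫⁻ c, flowEnergy n c ∂offspringLaw μ = energyFactor μ ^ n * offspringLaw μ survSet := by
  induction n with
  | zero => simp [flowEnergy, lintegral_indicator_one measurableSet_survSet]
  | succ n ih =>
    rw [flowEnergy, lintegral_energyStep μ (measurable_flowEnergy n) fun c => flowEnergy_eq_zero n,
      ih, pow_succ']
    ring

lemma toMeasure_two_le_ne_zero (hμ : 1 < ∑' i : ℕ, (i : ℝ≥0∞) * μ i) :
    μ.toMeasure {k | 2 ≤ k} ≠ 0 := by
  intro h
  refine hμ.not_ge ?_
  have h0 : ∀ i, 2 ≤ i → μ i = 0 := by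
    intro i hi
    have h1 := (PMF.toMeasure_apply_eq_zero_iff μ (MeasurableSet.of_discrete)).1 h
    by_contra hne
    exact Set.disjoint_left.1 h1 ((PMF.mem_support_iff μ i).2 hne) hi
  rw [tsum_eq_single 1]
  · simpa using PMF.coe_le_one μ 1
  · intro i hi
    rcases Nat.lt_or_ge i 2 with h2 | h2
    · have : i = 0 := by omega
      simp [this]
    · simp [h0 i h2]

lemma offspringLaw_two_le_survDegree_ne_zero (hμ : 1 < ∑' i : ℕ, (i : ℝ≥0∞) * μ i)
    (hq : offspringLaw μ survSet ≠ 0) : offspringLaw μ {c | 2 ≤ survDegree c} ≠ 0 := by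
  have hS : Measurable (survSet.indicator (1 : (List ℕ → ℕ) → ℝ≥0∞)) :=
    measurable_one.indicator measurableSet_survSet
  have hmeas : MeasurableSet {c : List ℕ → ℕ | 2 ≤ c []} :=
    measurableSet_le measurable_const (measurable_pi_apply [])
  have h2 : Measurable ({c : List ℕ → ℕ | 2 ≤ c []}.indicator (1 : (List ℕ → ℕ) → ℝ≥0∞)) :=
    measurable_one.indicator hmeas
  have htwo : ∀ i c, {c : List ℕ → ℕ | 2 ≤ c []}.indicator (1 : (List ℕ → ℕ) → ℝ≥0∞)
      (eraseSubtree i c) = {c : List ℕ → ℕ | 2 ≤ c []}.indicator 1 c := by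
    intro i c
    by_cases hc : 2 ≤ c [] <;> simp [hc, eraseSubtree_nil]
  have hroot : offspringLaw μ {c | 2 ≤ c []} = μ.toMeasure {k | 2 ≤ k} := by
    conv_rhs => rw [← Measure.infinitePi_map_eval (fun _ : List ℕ => μ.toMeasure) []]
    rw [Measure.map_apply (measurable_pi_apply _) MeasurableSet.of_discrete]
    rfl
  have h3 := lintegral_mul_subtree μ (i := 1) h2
    (fun c => htwo 1 c) hS
  have h4 := lintegral_mul_subtree μ (i := 0) (h2.mul (hS.comp (measurable_subtree 1)))
    (fun c => by rw [Pi.mul_apply, Pi.mul_apply, htwo, Function.comp_apply, Function.comp_apply,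
      subtree_eraseSubtree one_ne_zero]) hS
  simp only [Pi.mul_apply, Function.comp_apply] at h4
  rw [h3, lintegral_indicator_one hmeas, lintegral_indicator_one measurableSet_survSet,
    hroot] at h4
  intro h0
  refine mul_ne_zero (mul_ne_zero (toMeasure_two_le_ne_zero μ hμ) hq) hq ?_
  rw [← h4, ← nonpos_iff_eq_zero, ← h0,
    ← lintegral_indicator_one (measurableSet_le measurable_const measurable_survDegree)]
  refine lintegral_mono fun c => ?_
  by_cases hc : c ∈ survChild 0 ∩ survChild 1
  · have hD : c ∈ {c | 2 ≤ survDegree c} := by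
      have := ENNReal.sum_le_tsum
        (f := fun i => (survChild i).indicator (1 : (List ℕ → ℕ) → ℝ≥0∞) c) {0, 1}
      rw [Finset.sum_pair (by simp), Set.indicator_of_mem hc.1, Set.indicator_of_mem hc.2,
        Pi.one_apply, one_add_one_eq_two] at this
      exact this
    rw [Set.indicator_of_mem hD]
    have hle : ∀ (s : Set (List ℕ → ℕ)) (c : List ℕ → ℕ),
        s.indicator (1 : (List ℕ → ℕ) → ℝ≥0∞) c ≤ 1 := fun s c =>
      Set.indicator_le_self' (fun _ _ => zero_le) _
    exact mul_le_one' (mul_le_one' (hle _ _) (hle _ _)) (hle _ _)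
  · refine le_of_eq_of_le ?_ zero_le
    simp only [mul_eq_zero, Set.indicator_apply_eq_zero, Pi.one_apply, one_ne_zero, imp_false]
    by_contra! hcon
    exact hc ⟨⟨lt_of_lt_of_le (by simp) hcon.1.1, hcon.2⟩, ⟨hcon.1.1, hcon.1.2⟩⟩

/-- As the surviving root branches with positive probability, the mean energy decreases
exponentially fast. -/
lemma energyFactor_lt_one (hμ : 1 < ∑' i : ℕ, (i : ℝ≥0∞) * μ i)
    (hq : offspringLaw μ survSet ≠ 0) : energyFactor μ < 1 := by
  have h1 := lintegral_flowEnergy μ 1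
  rw [pow_one] at h1
  have hm : MeasurableSet {c | 2 ≤ survDegree c} :=
    measurableSet_le measurable_const measurable_survDegree
  have hpt : ∀ c, flowEnergy 1 c + 2⁻¹ * {c | 2 ≤ survDegree c}.indicator 1 c ≤
      survSet.indicator 1 c := by
    intro c
    have hE : flowEnergy 1 c = (survDegree c)⁻¹ ^ 2 * survDegree c := by
      rw [← tsum_survChild_const]
      refine tsum_congr fun i => ?_
      by_cases h : c ∈ survChild i
      · simp [h, flowEnergy, h.2]
      · simp [h]
    by_cases hc : c ∈ survSet
    · have hD1 := one_le_survDegree hc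
      have hD0 : survDegree c ≠ 0 := (zero_lt_one.trans_le hD1).ne'
      rw [hE, pow_two, mul_assoc, ENNReal.inv_mul_cancel hD0 (survDegree_ne_top c), mul_one,
        Set.indicator_of_mem hc]
      by_cases h2 : c ∈ {c | 2 ≤ survDegree c}
      · rw [Set.indicator_of_mem h2, Pi.one_apply, mul_one,
          ← ENNReal.inv_two_add_inv_two]
        gcongr
        exact h2
      · rw [Set.indicator_of_notMem h2, mul_zero, add_zero]
        exact ENNReal.inv_le_one.2 hD1
    · rw [hE, survDegree_eq_zero hc, mul_zero, zero_add, Set.indicator_of_notMem, mul_zero]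
      · exact zero_le
      · simp [survDegree_eq_zero hc]
  have hint := lintegral_mono (μ := offspringLaw μ) hpt
  rw [lintegral_add_left (measurable_flowEnergy 1), h1,
    lintegral_const_mul _ (measurable_one.indicator hm), lintegral_indicator_one hm,
    lintegral_indicator_one measurableSet_survSet] at hint
  have hpos : 2⁻¹ * offspringLaw μ {c | 2 ≤ survDegree c} ≠ 0 :=
    mul_ne_zero (by simp) (offspringLaw_two_le_survDegree_ne_zero μ hμ hq)
  have hfin : energyFactor μ * offspringLaw μ survSet ≠ ⊤ :=
    ((le_self_add.trans hint).trans_lt (measure_lt_top _ _)).ne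
  have hlt := (ENNReal.lt_add_right hfin hpos).trans_le hint
  by_contra! hge
  exact hlt.not_ge (le_mul_of_one_le_left zero_le hge)

lemma tsum_sq_mul_pow_ne_top {r : ℝ≥0∞} (hr : r < 1) :
    ∑' n : ℕ, ((2 * n + 2 : ℕ) : ℝ≥0∞) ^ 2 * r ^ n ≠ ⊤ := by
  lift r to NNReal using hr.ne_top
  have hr' : r < 1 := by exact_mod_cast hr
  have hs : Summable fun n : ℕ => (((2 * n + 2 : ℕ) : NNReal)) ^ 2 * r ^ n := by
    rw [← NNReal.summable_coe]
    have hn : ‖(r : ℝ)‖ < 1 := by simpa using hr'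
    have h0 := summable_pow_mul_geometric_of_norm_lt_one 0 hn
    have h1 := summable_pow_mul_geometric_of_norm_lt_one 1 hn
    have h2 := summable_pow_mul_geometric_of_norm_lt_one 2 hn
    refine (((h2.mul_left 4).add (h1.mul_left 8)).add (h0.mul_left 4)).congr fun n => ?_
    push_cast
    ring
  have := ENNReal.tsum_coe_ne_top_iff_summable.2 hs
  simpa using this

/-- Almost surely on survival, the equally splitting flow is thin. -/
theorem ae_isThin_splitFlow (hμ : 1 < ∑' i : ℕ, (i : ℝ≥0∞) * μ i) :
    ∀ᵐ c ∂offspringLaw μ, c ∈ survSet → IsThin fun u => splitFlow u c := by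
  -- Supercriticality makes survival possible, but this is not needed for the claim.
  by_cases hq : offspringLaw μ survSet = 0
  · filter_upwards [measure_eq_zero_iff_ae_notMem.1 hq] with c hc h
    exact absurd h hc
  have hmeas : ∀ n : ℕ, Measurable fun c => ((2 * n + 2 : ℕ) : ℝ≥0∞) ^ 2 * flowEnergy n c :=
    fun n => measurable_const.mul (measurable_flowEnergy n)
  have hint :
      ∫⁻ c, ∑' n : ℕ, ((2 * n + 2 : ℕ) : ℝ≥0∞) ^ 2 * flowEnergy n c ∂offspringLaw μ ≠ ⊤ := by
    rw [lintegral_tsum fun n => (hmeas n).aemeasurable]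
    have h : ∀ n : ℕ, ∫⁻ c, ((2 * n + 2 : ℕ) : ℝ≥0∞) ^ 2 * flowEnergy n c ∂offspringLaw μ =
        ((2 * n + 2 : ℕ) : ℝ≥0∞) ^ 2 * energyFactor μ ^ n * offspringLaw μ survSet := by
      intro n
      rw [lintegral_const_mul _ (measurable_flowEnergy n), lintegral_flowEnergy, mul_assoc]
    simp_rw [h]
    rw [ENNReal.tsum_mul_right]
    exact ENNReal.mul_ne_top (tsum_sq_mul_pow_ne_top (energyFactor_lt_one μ hμ hq))
      (measure_ne_top _ _)
  filter_upwards [ae_lt_top (Measurable.tsum hmeas) hint] with c hc _ ε hε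
  have htend := ENNReal.tendsto_atTop_zero_of_tsum_ne_top hc.ne
  obtain ⟨k, hk⟩ := Filter.eventually_atTop.1
    (htend.eventually (ge_mem_nhds (pos_iff_ne_zero.2 (pow_ne_zero 2 hε))))
  refine ⟨k, fun u hu => ?_⟩
  by_contra! hlt
  refine (ENNReal.pow_lt_pow_left two_ne_zero hlt).not_ge (le_trans ?_ (hk u.length hu))
  rw [mul_pow]
  gcongr
  exact splitFlow_sq_le u c

end Law

end CausalMaps

open CausalMaps in
theorem theorem1 {Ω : Type*} [MeasurableSpace Ω] (P : Measure Ω) [IsProbabilityMeasure P]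
    (μ : PMF ℕ) (hμ : 1 < ∑' i : ℕ, (i : ℝ≥0∞) * μ i)
    (N : List ℕ → Ω → ℕ) (hN : ∀ u, Measurable (N u)) (hindep : iIndepFun N P)
    (hlaw : ∀ u, P.map (N u) = μ.toMeasure) :
    (∀ᵐ ω ∂(ProbabilityTheory.cond P (CausalMaps.survival N)),
      (CausalMaps.causalMap (CausalMaps.gwTree N ω)).WeaklyAnchoredHyperbolic) ∧
    (∀ᵐ ω ∂(ProbabilityTheory.cond P (CausalMaps.survival N)),
      ∃ γ : ℤ → List ℕ,
        CausalMaps.IsBiinfiniteGeodesic (CausalMaps.causalMap (CausalMaps.gwTree N ω)).graph γ) := by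
  have hmeas : Measurable fun ω u => N u ω := measurable_pi_iff.2 hN
  have hmap : P.map (fun ω u => N u ω) = offspringLaw μ := by
    rw [hindep.map_fun_eq_infinitePi_map hN, offspringLaw]
    simp_rw [hlaw]
  have hsurv : MeasurableSet (survival N) := hmeas measurableSet_survSet
  have hthin : ∀ᵐ ω ∂P, (fun u => N u ω) ∈ survSet →
      IsThin fun u => splitFlow u fun v => N v ω :=
    ae_of_ae_map hmeas.aemeasurable (hmap ▸ ae_isThin_splitFlow μ hμ)
  have hflow : ∀ᵐ ω ∂(ProbabilityTheory.cond P (survival N)),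
      ∃ ν, IsFlow (gwTree N ω) ν ∧ IsThin ν := by
    filter_upwards [cond_absolutelyContinuous.ae_le hthin, ae_cond_mem hsurv] with ω h1 h2
    exact ⟨_, isFlow_splitFlow h2, h1 h2⟩
  refine ⟨?_, ?_⟩
  · filter_upwards [hflow] with ω ⟨ν, hν, ht⟩
    exact hν.weaklyAnchoredHyperbolic ht
  · filter_upwards [hflow] with ω ⟨ν, hν, ht⟩
    exact hν.exists_isBiinfiniteGeodesic ht
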